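/- Let $m,n\in\mathbb N$ and $\ell>0$. For $\xi\in\mathbb R^{m\times n}$ let $|\xi|=(\sum_{i,j}\xi_{ij}^2)^{1/2}$ be the Euclidean norm and let $$h(\xi):=\min\{|\xi|^2,\ \ell|\xi|\}.$$ Denote by $h^{\rm conv}$ the convex envelope of $h$, i.e. the largest convex function $\mathbb R^{m\times n}\to\mathbb R$ that is $\le h$, and by $$h^{\rm qc}(\xi):=\inf\Big\{\int_{(0,1)^n}h(\xi+\nabla\varphi)\,dx:\ \varphi\in C^\infty_c((0,1)^n;\mathbb R^m)\Big\}$$ its quasiconvex envelope. Then, for every $\xi\in\mathbb R^{m\times n}$: (i) if $|\xi|\le \ell/2$, then $h(\xi)=h^{\rm qc}(\xi)=h^{\rm conv}(\xi)$; (ii) if $\operatorname{rank}\xi\le 1$, then $h^{\rm qc}(\xi)=h^{\rm conv}(\xi)$; (iii) if $\operatorname{rank}\xi\ge 2$ and $|\xi|>\ell/2$, then $h^{\rm conv}(\xi)<h^{\rm qc}(\xi)$. In particular, if $m,n\ge 2$, then $h^{\rm qc}$ is not convex. -/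

import Mathlib

open MeasureTheory Set
open scoped ContDiff

/- Matrices carry the Euclidean (Frobenius) norm `‖ξ‖ ^ 2 = ∑ i, ∑ j, ξ i j ^ 2`. -/
attribute [local instance] Matrix.frobeniusNormedAddCommGroup

noncomputable section

/-- The open unit cube `(0,1)^n`. -/
def unitCube (n : ℕ) : Set (EuclideanSpace ℝ (Fin n)) :=
  {x | ∀ i, x i ∈ Ioo (0 : ℝ) 1}

/-- The gradient matrix `(∇φ)_{ij} = ∂_j φ_i`. -/
def gradMatrix {m n : ℕ} (φ : EuclideanSpace ℝ (Fin n) → EuclideanSpace ℝ (Fin m))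
    (x : EuclideanSpace ℝ (Fin n)) : Matrix (Fin m) (Fin n) ℝ :=
  Matrix.of fun i j => fderiv ℝ φ x (EuclideanSpace.single j 1) i

/-- `φ ∈ C_c^∞((0,1)^n; ℝ^m)`, with `φ` extended by zero to the whole space. -/
structure IsCubeTestFunction {m n : ℕ}
    (φ : EuclideanSpace ℝ (Fin n) → EuclideanSpace ℝ (Fin m)) : Prop where
  contDiff : ContDiff ℝ ∞ φ
  hasCompactSupport : HasCompactSupport φ
  tsupport_subset : tsupport φ ⊆ unitCube n

/-- The quasiconvex envelope
`h^qc(ξ) = inf {∫_{(0,1)^n} h(ξ + ∇φ) dx : φ ∈ C_c^∞((0,1)^n; ℝ^m)}`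
(meaningful for continuous `h ≥ 0`: then all the integrals exist and are nonnegative). -/
def qcEnvelope {m n : ℕ} (h : Matrix (Fin m) (Fin n) ℝ → ℝ)
    (ξ : Matrix (Fin m) (Fin n) ℝ) : ℝ :=
  sInf {r : ℝ | ∃ φ : EuclideanSpace ℝ (Fin n) → EuclideanSpace ℝ (Fin m),
    IsCubeTestFunction φ ∧ r = ∫ x in unitCube n, h (ξ + gradMatrix φ x)}

/-- The convex envelope: the pointwise supremum of all convex functions below `h`
(meaningful when there is at least one, as for `h ≥ 0`). -/
def convEnvelope {m n : ℕ} (h : Matrix (Fin m) (Fin n) ℝ → ℝ)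
    (ξ : Matrix (Fin m) (Fin n) ℝ) : ℝ :=
  sSup {r : ℝ | ∃ g : Matrix (Fin m) (Fin n) ℝ → ℝ,
    ConvexOn ℝ univ g ∧ (∀ η, g η ≤ h η) ∧ r = g ξ}

/-- The simplified energy density `h(ξ) = |ξ|² ∧ ℓ|ξ|`. -/
def hSimp (m n : ℕ) (ℓ : ℝ) (ξ : Matrix (Fin m) (Fin n) ℝ) : ℝ :=
  min (‖ξ‖ ^ 2) (ℓ * ‖ξ‖)

end

/-! The convex envelope of `h` is the Huber function of the norm: quadratic up to `ℓ/2`, then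
continued by its tangent of slope `ℓ` (`convEnvelope_hSimp`). Its affine supports lie below `h` and
`∇φ` has mean zero, so it also bounds the quasiconvex envelope from below (`huber_le_qcEnvelope`).
On the ball of radius `ℓ/2` it equals `h`, which squeezes the three functions together.

Outside this ball the Huber value is approached by splitting `ξ` into a multiple of norm `ℓ/2` and a
huge multiple on a set of small measure. For `ξ = a ⊗ b` gradients can do this: plane waves in
direction `b`, cut off near the boundary of the cube (`qcEnvelope_vecMulVec_le`).

If `ξ` has a nonzero two-by-two minor, gradients cannot concentrate in this way
(`exists_huber_add_le_setIntegral`). Put `N = ξ/|ξ|`, `η = ξ + ∇φ`, `s = ⟨N, η⟩`. The excess `e =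
h(η) - ℓ s + ℓ²/4` is nonnegative and its integral is `∫ h(η)` minus the Huber value. Where `e` is
small, `η` is close to `s N`, and `s` is close to `ℓ/2` unless `|η|` is large, which costs at least
`ℓ²/4`. On each planar slice, inverting the minor turns two components of `φ` into `u, v` with `∂₁u
≈ ∂₂v ≈ p - κ` and `∂₂u ≈ ∂₁v ≈ 0`, where `p = s - ℓ/2` and `κ = |ξ| - ℓ/2 > 0`. As `∂₁u` has mean
zero, `p` has mean about `κ`, although `p ≈ 0` off a set of small area.

Such a set cannot carry this mass. In the spirit of the covering of planar null sets by Alberti,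
Csörnyei and Preiss, it is covered by thin strips around Lipschitz graphs over one axis or the
other, of total area at most of the order of the square root of the excess
(`exists_isThin_cover_superlevel`). Along a graph over the first axis, `∂₁u` differs by at most
`|∂₂u|` from a derivative with integral zero; for the other axis `v` plays this role. So `∫ p` over
the strips is small, a contradiction (`exists_le_setIntegral_of_gap`). -/

/-! ### Lattice points in steep and flat chains -/

/-- A finite set of lattice points any two of which are joined by a segment of slope
greater than one in absolute value. -/
def IsSteepChain (C : Finset (ℤ × ℤ)) : Prop :=
  ∀ p ∈ C, ∀ q ∈ C, p ≠ q → |q.1 - p.1| < |q.2 - p.2|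

/-- A finite set of lattice points any two of which are joined by a segment of slope
less than one in absolute value. -/
def IsFlatChain (C : Finset (ℤ × ℤ)) : Prop :=
  ∀ p ∈ C, ∀ q ∈ C, p ≠ q → |q.2 - p.2| < |q.1 - p.1|

lemma IsFlatChain.mono {C D : Finset (ℤ × ℤ)} (h : IsFlatChain D) (hCD : C ⊆ D) :
    IsFlatChain C :=
  fun p hp q hq hpq => h p (hCD hp) q (hCD hq) hpq

/-- A flat chain and a steep chain share at most one point. -/
lemma card_inter_le_one_of_flat_of_steep {C D : Finset (ℤ × ℤ)} (hC : IsFlatChain C)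
    (hD : IsSteepChain D) : (C ∩ D).card ≤ 1 := by
  rw [Finset.card_le_one]
  intro a ha b hb
  by_contra hab
  rw [Finset.mem_inter] at ha hb
  exact lt_asymm (hC a ha.1 b hb.1 hab) (hD a ha.2 b hb.2 hab)

/-- A finite planar set splits into a part without long steep chains and a part without long
flat chains. -/
lemma exists_split_steep_flat (k : ℕ) (B : Finset (ℤ × ℤ)) :
    ∃ B₁ B₂ : Finset (ℤ × ℤ), B ⊆ B₁ ∪ B₂ ∧
      (∀ C ⊆ B₁, IsSteepChain C → C.card < k + 1) ∧
      (∀ C ⊆ B₂, IsFlatChain C → C.card * (k + 1) ≤ B.card) := by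
  induction B using Finset.strongInduction with
  | H B ih =>
    -- Greedy removal of long steep chains: each removal takes at least `k + 1` points from `B` but
    -- at most one from any flat chain, which preserves the product bound.
    by_cases h : ∃ C ⊆ B, IsSteepChain C ∧ k + 1 ≤ C.card
    · obtain ⟨D, hDB, hD, hDk⟩ := h
      have hne : D.Nonempty := Finset.card_pos.mp (by omega)
      obtain ⟨B₁, B₂, hB, h1, h2⟩ := ih (B \ D) (Finset.sdiff_ssubset hDB hne)
      refine ⟨B₁, B₂ ∪ D, ?_, h1, ?_⟩
      · intro x hx
        by_cases hxD : x ∈ D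
        · simp [hxD]
        · have := hB (Finset.mem_sdiff.mpr ⟨hx, hxD⟩)
          simp only [Finset.mem_union] at this ⊢
          tauto
      · intro C hC hflat
        have h3 := h2 (C \ D) (by
          intro x hx
          rw [Finset.mem_sdiff] at hx
          have := hC hx.1
          rw [Finset.mem_union] at this
          tauto) (hflat.mono Finset.sdiff_subset)
        have h4 := card_inter_le_one_of_flat_of_steep hflat hD
        have h5 := Finset.card_sdiff_add_card_inter C D
        have h6 := Finset.card_sdiff_add_card_eq_card hDB
        rw [← h5, add_mul]
        nlinarith
    · push Not at h
      exact ⟨B, ∅, by simp, fun C hC hs => h C hC hs, by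
        intro C hC _
        rw [Finset.subset_empty.mp hC]
        simp⟩

/-- The lower envelope of the cones with vertices at the points of a finite set. -/
noncomputable def coneEnvelope (B : Finset (ℤ × ℤ)) (hB : B.Nonempty) (x : ℝ) : ℝ :=
  B.inf' hB fun p => (p.2 : ℝ) + |x - p.1|

lemma coneEnvelope_le {B : Finset (ℤ × ℤ)} (hB : B.Nonempty) {p : ℤ × ℤ} (hp : p ∈ B) (x : ℝ) :
    coneEnvelope B hB x ≤ p.2 + |x - p.1| :=
  Finset.inf'_le (fun p : ℤ × ℤ => (p.2 : ℝ) + |x - p.1|) hp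

lemma coneEnvelope_le_add {B : Finset (ℤ × ℤ)} (hB : B.Nonempty) (x y : ℝ) :
    coneEnvelope B hB x ≤ coneEnvelope B hB y + |x - y| := by
  obtain ⟨p, hp, h⟩ := Finset.exists_mem_eq_inf' hB (fun p : ℤ × ℤ => (p.2 : ℝ) + |y - p.1|)
  have h1 := coneEnvelope_le hB hp x
  have h2 : coneEnvelope B hB y = p.2 + |y - p.1| := h
  have h3 := abs_sub_le x y (p.1 : ℝ)
  linarith

/-- A finite set of lattice points without long steep chains is covered by few ordered,
separated Lipschitz graphs. -/
lemma exists_lipschitz_graphs (k : ℕ) : ∀ (B : Finset (ℤ × ℤ)),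
    (∀ C ⊆ B, IsSteepChain C → C.card < k + 1) →
    ∀ G : ℝ → ℝ, (∀ x y, G x ≤ G y + |x - y|) → (∀ p ∈ B, G p.1 ≤ p.2) →
    ∃ F : ℕ → ℝ → ℝ, (∀ x, G x ≤ F 0 x) ∧ (∀ i x y, F i x ≤ F i y + |x - y|) ∧
      (∀ i x, F i x + 1 ≤ F (i + 1) x) ∧ ∀ p ∈ B, ∃ i < k, F i p.1 = p.2 := by
  induction k with
  | zero =>
    intro B hB G hG _
    refine ⟨fun i x => G x + i, by simp, fun i x y => ?_, fun i x => ?_, fun p hp => ?_⟩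
    · have := hG x y
      simp only
      linarith
    · push_cast
      linarith
    -- A single point is a steep chain, so for `k = 0` the set `B` has no points.
    · have := hB {p} (by simpa using hp) (by
        intro a ha b hb hab
        simp only [Finset.mem_singleton] at ha hb
        exact absurd (ha.trans hb.symm) hab)
      simp at this
  | succ k ih =>
    intro B hB G hG hGB
    rcases B.eq_empty_or_nonempty with rfl | hne
    · refine ⟨fun i x => G x + i, by simp, fun i x y => ?_, fun i x => ?_, by simp⟩
      · have := hG x y
        simp only
        linarith
      · push_cast
        linarith
    · classical
      set E := coneEnvelope B hne with hE
      -- As in Mirsky's theorem, the minimal elements are peeled off: points with no other point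
      -- steeply below them lie on the envelope `E`, and the remaining set `B'` has shorter steep
      -- chains.
      set B' := B.filter fun p => ∃ q ∈ B, |q.1 - p.1| < p.2 - q.2 with hB'
      have hB'B : B' ⊆ B := Finset.filter_subset _ _
      obtain ⟨F, hF0, hFl, hFs, hFB⟩ := ih B' (by
        intro C hC hs
        by_contra hcon
        push Not at hcon
        have hCne : C.Nonempty := Finset.card_pos.mp (by omega)
        obtain ⟨p, hp, hmin⟩ := C.exists_min_image (fun q => q.2) hCne
        obtain ⟨_, q, hq, hqp⟩ := Finset.mem_filter.mp (hC hp)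
        -- Steep cones nest: a point steeply below the lowest point of `C` is steeply below all of
        -- `C`. Inserting it would give too long a steep chain in `B`.
        have key : ∀ c ∈ C, |q.1 - c.1| < c.2 - q.2 := by
          intro c hc
          by_cases hcp : c = p
          · rw [hcp]; exact hqp
          · have h1 := hs p hp c hc (Ne.symm hcp)
            have h2 := hmin c hc
            rw [abs_of_nonneg (by linarith : (0:ℤ) ≤ c.2 - p.2)] at h1
            have h3 := abs_sub_le q.1 p.1 c.1
            rw [abs_sub_comm p.1 c.1] at h3
            linarith
        have hqC : q ∉ C := fun h => by
          have := key q h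
          simp at this
        have := hB (insert q C) (by
          intro x hx
          rcases Finset.mem_insert.mp hx with rfl | hx
          · exact hq
          · exact hB'B (hC hx)) (by
          intro a ha b hb hab
          rcases Finset.mem_insert.mp ha with rfl | ha' <;>
          rcases Finset.mem_insert.mp hb with rfl | hb'
          · exact absurd rfl hab
          · have := key b hb'
            rw [abs_sub_comm]
            exact this.trans_le (le_abs_self _)
          · have := key a ha'
            rw [abs_sub_comm b.2]
            exact this.trans_le (le_abs_self _)
          · exact hs a ha' b hb' hab)
        rw [Finset.card_insert_of_notMem hqC] at this
        omega) (fun x => E x + 1) (fun x y => by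
          have := coneEnvelope_le_add hne x y
          linarith) (by
        intro p hp
        obtain ⟨_, q, hq, hqp⟩ := Finset.mem_filter.mp hp
        have h1 := coneEnvelope_le hne hq (p.1 : ℝ)
        -- A strict inequality between integers leaves a gap of one; this is what separates
        -- consecutive graphs.
        have h2 : ((|q.1 - p.1| : ℤ) : ℝ) + 1 ≤ p.2 - q.2 := by exact_mod_cast hqp
        push_cast at h2
        rw [abs_sub_comm] at h2
        change E p.1 + 1 ≤ p.2
        linarith)
      refine ⟨fun i => Nat.casesOn i E F, ?_, ?_, ?_, ?_⟩
      · intro x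
        simp only
        refine (Finset.le_inf'_iff hne _).mpr fun p hp => ?_
        have := hG x p.1
        have := hGB p hp
        linarith
      · rintro (_ | i) x y
        · exact coneEnvelope_le_add hne x y
        · exact hFl i x y
      · rintro (_ | i) x
        · exact hF0 x
        · exact hFs i x
      · intro p hp
        by_cases hpB : p ∈ B'
        · obtain ⟨i, hi, h⟩ := hFB p hpB
          exact ⟨i + 1, by omega, h⟩
        · refine ⟨0, by omega, ?_⟩
          simp only
          refine le_antisymm ?_ ?_
          · simpa using coneEnvelope_le hne hp (p.1 : ℝ)
          · refine (Finset.le_inf'_iff hne _).mpr fun q hq => ?_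
            have h1 : ¬ |q.1 - p.1| < p.2 - q.2 := fun h =>
              hpB (Finset.mem_filter.mpr ⟨hp, q, hq, h⟩)
            push Not at h1
            have h2 : ((p.2 - q.2 : ℤ) : ℝ) ≤ ((|q.1 - p.1| : ℤ) : ℝ) := by exact_mod_cast h1
            push_cast at h2
            rw [abs_sub_comm] at h2
            linarith

/-! ### Thin neighbourhoods of Lipschitz graphs -/

/-- The half-open unit square. -/
def unitSquare : Set (ℝ × ℝ) := Ico 0 1 ×ˢ Ico 0 1

/-- The strip of vertical width `w` above the graph of `F`. -/
def graphStrip (F : ℝ → ℝ) (w : ℝ) : Set (ℝ × ℝ) := {z | F z.1 ≤ z.2 ∧ z.2 < F z.1 + w}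

lemma lipschitzWith_one_of_le_add {F : ℝ → ℝ} (hF : ∀ x y, F x ≤ F y + |x - y|) :
    LipschitzWith 1 F :=
  LipschitzWith.of_le_add fun x y => by simpa [Real.dist_eq] using hF x y

lemma measurableSet_graphStrip {F : ℝ → ℝ} (hF : Measurable F) (w : ℝ) :
    MeasurableSet (graphStrip F w) :=
  (measurableSet_le (hF.comp measurable_fst) measurable_snd).inter
    (measurableSet_lt measurable_snd ((hF.comp measurable_fst).add_const w))

/-- The shear `(x, t) ↦ (x, t + F x)`. -/
def verticalShear (F : ℝ → ℝ) (hF : Measurable F) : (ℝ × ℝ) ≃ᵐ (ℝ × ℝ) where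
  toFun z := (z.1, z.2 + F z.1)
  invFun z := (z.1, z.2 - F z.1)
  left_inv z := by simp
  right_inv z := by simp
  measurable_toFun := measurable_fst.prodMk (measurable_snd.add (hF.comp measurable_fst))
  measurable_invFun := measurable_fst.prodMk (measurable_snd.sub (hF.comp measurable_fst))

lemma measurePreserving_verticalShear (F : ℝ → ℝ) (hF : Measurable F) :
    MeasurePreserving (verticalShear F hF) volume volume :=
  (MeasurePreserving.id (volume : Measure ℝ)).skew_product
    (g := fun x t => t + F x) (μc := volume) (μd := volume)
    (measurable_snd.add (hF.comp measurable_fst))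
    (Filter.Eventually.of_forall fun x => map_add_right_eq_self volume (F x))

lemma verticalShear_preimage_graphStrip (F : ℝ → ℝ) (hF : Measurable F) (w : ℝ) :
    verticalShear F hF ⁻¹' graphStrip F w = univ ×ˢ Ico 0 w := by
  ext z
  simp [graphStrip, verticalShear, add_comm (F z.1)]

/-- Integration by parts against the constant `1`. Lipschitz regularity is all that is available,
since the graphs are lower envelopes of cones. -/
lemma integral_deriv_eq_zero_of_lipschitz {k : ℝ → ℝ} {C : NNReal} (hk : LipschitzWith C k)
    (hc : HasCompactSupport k) : ∫ x, deriv k x = 0 := by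
  have h := LipschitzWith.integral_lineDeriv_mul_eq (μ := volume)
    (LipschitzWith.const (1 : ℝ) : LipschitzWith 0 fun _ : ℝ => (1 : ℝ)) hk hc (-1)
  have h1 : ∀ x, lineDeriv ℝ (fun _ : ℝ => (1 : ℝ)) x (-1) = 0 := fun x => by simp [lineDeriv]
  simp only [h1, zero_mul, integral_zero, mul_one, neg_neg] at h
  have h2 : ∀ x, lineDeriv ℝ k x 1 = deriv k x := fun x => by
    rw [lineDeriv]
    have := deriv_comp_const_add (f := k) x 0
    simpa using this
  simp only [h2] at h
  exact h.symm

section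
variable {u : ℝ × ℝ → ℝ}

lemma continuous_fderiv_apply_const (hu : ContDiff ℝ 1 u) (v : ℝ × ℝ) :
    Continuous fun z => fderiv ℝ u z v :=
  (hu.continuous_fderiv (by norm_num)).clm_apply continuous_const

lemma integrable_fderiv_apply_const (hu : ContDiff ℝ 1 u) (hc : HasCompactSupport u)
    (v : ℝ × ℝ) : Integrable fun z => fderiv ℝ u z v :=
  (continuous_fderiv_apply_const hu v).integrable_of_hasCompactSupport (hc.fderiv_apply ℝ v)

/-- By the chain rule the integrand is, almost everywhere, the derivative of the compactly supported
Lipschitz function `x ↦ u (x, t + F x)`. -/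
lemma integral_deriv_along_graph_eq_zero (hu : ContDiff ℝ 1 u) (hc : HasCompactSupport u)
    {F : ℝ → ℝ} (hF : LipschitzWith 1 F) (t : ℝ) :
    ∫ x, (fderiv ℝ u (x, t + F x) (1, 0) + deriv F x * fderiv ℝ u (x, t + F x) (0, 1)) = 0 := by
  obtain ⟨C, hC⟩ := hu.lipschitzWith_of_hasCompactSupport hc (by norm_num)
  have hg : LipschitzWith (max 1 (0 + 1)) fun x : ℝ => (x, t + F x) :=
    LipschitzWith.id.prodMk ((LipschitzWith.const t).add hF)
  have hk := hC.comp hg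
  have hkc : HasCompactSupport (u ∘ fun x : ℝ => (x, t + F x)) := by
    refine HasCompactSupport.intro (hc.isCompact.image continuous_fst) fun x hx => ?_
    by_contra h
    exact hx ⟨_, subset_tsupport _ h, rfl⟩
  refine Eq.trans ?_ (integral_deriv_eq_zero_of_lipschitz hk hkc)
  refine integral_congr_ae ?_
  filter_upwards [hF.ae_differentiableAt_real] with x hx
  have h1 : HasDerivAt (fun x : ℝ => (x, t + F x)) (1, deriv F x) x :=
    (hasDerivAt_id x).prodMk (hx.hasDerivAt.const_add t)
  have h2 := ((hu.differentiable (by norm_num)) (x, t + F x)).hasFDerivAt.comp_hasDerivAt x h1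
  rw [h2.deriv]
  have h3 : ((1 : ℝ), deriv F x) = (1, 0) + deriv F x • ((0 : ℝ), (1 : ℝ)) := by simp
  rw [h3, map_add, map_smul, smul_eq_mul]

/-- Over a strip around a Lipschitz graph, the tangential derivative has no net mass. -/
lemma abs_integral_graphStrip_le (hu : ContDiff ℝ 1 u) (hc : HasCompactSupport u)
    {F : ℝ → ℝ} (hF : LipschitzWith 1 F) (w : ℝ) :
    |∫ z in graphStrip F w, fderiv ℝ u z (1, 0)| ≤
      ∫ z in graphStrip F w, |fderiv ℝ u z (0, 1)| := by
  have hFm : Measurable F := hF.continuous.measurable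
  have i1 := integrable_fderiv_apply_const hu hc (1, 0)
  have i2 := integrable_fderiv_apply_const hu hc (0, 1)
  have hb : ∀ x, |deriv F x| ≤ 1 := fun x => by
    simpa using norm_deriv_le_of_lipschitz (x₀ := x) hF
  have i3 : Integrable fun z : ℝ × ℝ => deriv F z.1 * fderiv ℝ u z (0, 1) :=
    i2.bdd_mul (c := 1) ((measurable_deriv F).comp measurable_fst).aestronglyMeasurable
      (Filter.Eventually.of_forall fun z => hb z.1)
  -- The shear straightens the strip to `ℝ × [0, w)` and preserves area; Fubini then reduces to the
  -- vertical translates of the graph.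
  have key : ∫ z in graphStrip F w,
      (fderiv ℝ u z (1, 0) + deriv F z.1 * fderiv ℝ u z (0, 1)) = 0 := by
    have hmp := measurePreserving_verticalShear F hFm
    have hint := (hmp.integrable_comp_emb (verticalShear F hFm).measurableEmbedding).mpr
      (i1.add i3)
    rw [← hmp.setIntegral_preimage_emb (verticalShear F hFm).measurableEmbedding,
      verticalShear_preimage_graphStrip, Measure.volume_eq_prod, ← Measure.prod_restrict,
      Measure.restrict_univ, integral_prod_symm]
    · refine (integral_congr_ae (Filter.Eventually.of_forall fun t => ?_)).trans
        (integral_zero _ _)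
      exact integral_deriv_along_graph_eq_zero hu hc hF t
    · have := hint.integrableOn (s := univ ×ˢ Ico 0 w)
      rw [IntegrableOn, Measure.volume_eq_prod, ← Measure.prod_restrict,
        Measure.restrict_univ] at this
      exact this
  rw [integral_add i1.integrableOn i3.integrableOn] at key
  rw [eq_neg_of_add_eq_zero_left key, abs_neg]
  refine (abs_integral_le_integral_abs).trans ?_
  refine integral_mono i3.integrableOn.abs i2.integrableOn.abs fun z => ?_
  simp only [abs_mul]
  exact mul_le_of_le_one_left (abs_nonneg _) (hb z.1)

end

lemma volume_real_graphStrip_inter_le {F : ℝ → ℝ} (hF : Measurable F) {w : ℝ} (hw : 0 ≤ w) :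
    volume.real (graphStrip F w ∩ unitSquare) ≤ w := by
  have hm : MeasurableSet (graphStrip F w ∩ unitSquare) :=
    (measurableSet_graphStrip hF w).inter (measurableSet_Ico.prod measurableSet_Ico)
  refine ENNReal.toReal_le_of_le_ofReal hw ?_
  rw [Measure.volume_eq_prod, Measure.prod_apply hm]
  calc ∫⁻ x, volume (Prod.mk x ⁻¹' (graphStrip F w ∩ unitSquare))
      ≤ ∫⁻ x, (Ico (0 : ℝ) 1).indicator (fun _ => ENNReal.ofReal w) x := by
        refine lintegral_mono fun x => ?_
        by_cases hx : x ∈ Ico (0 : ℝ) 1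
        · rw [indicator_of_mem hx]
          refine (measure_mono (t := Ico (F x) (F x + w)) fun y hy => hy.1).trans ?_
          simp
        · rw [indicator_of_notMem hx, nonpos_iff_eq_zero]
          convert measure_empty (μ := (volume : Measure ℝ))
          ext y
          simp only [mem_preimage, mem_inter_iff, mem_empty_iff_false, iff_false]
          exact fun h => hx h.2.1
    _ = ENNReal.ofReal w := by
        rw [lintegral_indicator measurableSet_Ico]
        simp

/-- A planar set of small area on which `∫ ∂₁u` is controlled by `‖∂₂u‖₁`. -/
structure IsThin (T : Set (ℝ × ℝ)) (a : ℝ) : Prop where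
  measurableSet : MeasurableSet T
  area_le : volume.real (T ∩ unitSquare) ≤ a
  abs_integral_le : ∀ u : ℝ × ℝ → ℝ, ContDiff ℝ 1 u → HasCompactSupport u →
    |∫ z in T, fderiv ℝ u z (1, 0)| ≤ ∫ z, |fderiv ℝ u z (0, 1)|

/-- A disjoint union of strips around Lipschitz graphs is thin. -/
lemma isThin_iUnion_graphStrip {F : ℕ → ℝ → ℝ} {w : ℝ} (hw : 0 ≤ w)
    (hF : ∀ i x y, F i x ≤ F i y + |x - y|) (hs : ∀ i x, F i x + w ≤ F (i + 1) x) (k : ℕ) :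
    IsThin (⋃ i ∈ Finset.range k, graphStrip (F i) w) (k * w) := by
  have hL i := lipschitzWith_one_of_le_add (hF i)
  have hm i : MeasurableSet (graphStrip (F i) w) :=
    measurableSet_graphStrip (hL i).continuous.measurable w
  have hlt : ∀ i j, i < j → ∀ x, F i x + w ≤ F j x := by
    intro i j hij x
    induction j, hij using Nat.le_induction with
    | base => exact hs i x
    | succ j hij ih => linarith [hs j x]
  -- Disjointness makes the bound independent of the number of strips: the integrals of `|∂₂u|` add
  -- up to at most the full one.
  have hd : Pairwise (Function.onFun Disjoint fun i => graphStrip (F i) w) := by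
    intro i j hij
    rw [Function.onFun, Set.disjoint_left]
    rintro z ⟨h1, h2⟩ ⟨h3, h4⟩
    rcases lt_or_gt_of_ne hij with h | h
    · linarith [hlt i j h z.1]
    · linarith [hlt j i h z.1]
  refine ⟨Finset.measurableSet_biUnion _ fun i _ => hm i, ?_, fun u hu hc => ?_⟩
  · rw [iUnion₂_inter]
    refine (measureReal_biUnion_finset_le _ _).trans ?_
    refine (Finset.sum_le_sum fun i _ =>
      volume_real_graphStrip_inter_le (hL i).continuous.measurable hw).trans ?_
    simp
  · have i1 := integrable_fderiv_apply_const hu hc (1, 0)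
    have i2 := (integrable_fderiv_apply_const hu hc (0, 1)).abs
    rw [integral_biUnion_finset _ (fun i _ => hm i) (hd.set_pairwise _)
      fun i _ => i1.integrableOn]
    refine (Finset.abs_sum_le_sum_abs _ _).trans ?_
    refine (Finset.sum_le_sum fun i _ => abs_integral_graphStrip_le hu hc (hL i) w).trans ?_
    rw [← integral_biUnion_finset _ (fun i _ => hm i) (hd.set_pairwise _)
      fun i _ => i2.integrableOn]
    exact setIntegral_le_integral i2 (Filter.Eventually.of_forall fun z => abs_nonneg _)

/-- The grid cell of side `w` with lower left corner `w • p`. -/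
def gridCell (w : ℝ) (p : ℤ × ℤ) : Set (ℝ × ℝ) :=
  Ico (p.1 * w) ((p.1 + 1) * w) ×ˢ Ico (p.2 * w) ((p.2 + 1) * w)

/-- Grid cells without long steep chains are covered by two thin sets. -/
lemma exists_isThin_cover {k : ℕ} {B : Finset (ℤ × ℤ)}
    (hB : ∀ C ⊆ B, IsSteepChain C → C.card < k + 1) {w : ℝ} (hw : 0 < w) :
    ∃ T T' : Set (ℝ × ℝ), IsThin T (k * w) ∧ IsThin T' (k * w) ∧
      ∀ p ∈ B, gridCell w p ⊆ T ∪ T' := by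
  obtain ⟨m, hm⟩ : ∃ m : ℝ, ∀ p ∈ B, m ≤ p.2 := by
    obtain ⟨m, hm⟩ := (B.image fun p => (p.2 : ℝ)).bddBelow
    exact ⟨m, fun p hp => hm (Finset.mem_coe.mpr (Finset.mem_image_of_mem _ hp))⟩
  obtain ⟨F, -, hF, hs, hc⟩ := exists_lipschitz_graphs k B hB (fun _ => m)
    (fun x y => by have := abs_nonneg (x - y); linarith) hm
  have hF' : ∀ (a : ℝ) (i : ℕ) (x y : ℝ), w * F i (x / w - 1 / 2) + a ≤
      w * F i (y / w - 1 / 2) + a + |x - y| := by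
    intro a i x y
    have h1 := mul_le_mul_of_nonneg_left (hF i (x / w - 1 / 2) (y / w - 1 / 2)) hw.le
    have h2 : w * |x / w - 1 / 2 - (y / w - 1 / 2)| = |x - y| := by
      rw [← abs_of_pos hw, ← abs_mul, abs_of_pos hw]
      congr 1
      field_simp
      ring
    linarith
  have hs' : ∀ (a : ℝ) (i : ℕ) (x : ℝ), w * F i (x / w - 1 / 2) + a + w ≤
      w * F (i + 1) (x / w - 1 / 2) + a := by
    intro a i x
    have := mul_le_mul_of_nonneg_left (hs i (x / w - 1 / 2)) hw.le
    linarith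
  -- Over the cell of `p` the rescaled graph stays within `w / 2` of height `w * p.2`, so the cell
  -- fits into a strip of width `2 * w` around it. The graphs are only known to be `w` apart, so
  -- this strip is halved and the halves go to two families.
  refine ⟨_, _, isThin_iUnion_graphStrip hw.le (hF' (w / 2)) (hs' (w / 2)) k,
    isThin_iUnion_graphStrip hw.le (hF' (w / 2 - w)) (hs' (w / 2 - w)) k, ?_⟩
  rintro p hp ⟨x, y⟩ ⟨⟨hx1, hx2⟩, hy1, hy2⟩
  obtain ⟨i, hi, hip⟩ := hc p hp
  simp only at hx1 hx2 hy1 hy2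
  have hx : |x / w - 1 / 2 - p.1| ≤ 1 / 2 := by
    rw [← le_div_iff₀ hw] at hx1
    rw [← div_lt_iff₀ hw] at hx2
    rw [abs_le]
    constructor <;> linarith
  have h1 := hF i (x / w - 1 / 2) p.1
  have h2 := hF i p.1 (x / w - 1 / 2)
  rw [abs_sub_comm] at h2
  have h3 : w * F i (x / w - 1 / 2) ≤ w * (p.2 + 1 / 2) :=
    mul_le_mul_of_nonneg_left (by linarith) hw.le
  have h4 : w * (p.2 - 1 / 2) ≤ w * F i (x / w - 1 / 2) :=
    mul_le_mul_of_nonneg_left (by linarith) hw.le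
  simp only [mem_union, mem_iUnion, Finset.mem_range, graphStrip, mem_ofPred_eq]
  by_cases h : w * F i (x / w - 1 / 2) + w / 2 ≤ y
  · exact Or.inl ⟨i, hi, h, by linarith⟩
  · exact Or.inr ⟨i, hi, by linarith, by linarith⟩

/-! ### Approximately conformal diagonal gradients on the unit square -/

lemma measurableSet_unitSquare : MeasurableSet unitSquare :=
  measurableSet_Ico.prod measurableSet_Ico

lemma volume_unitSquare : volume unitSquare = 1 := by
  rw [unitSquare, Measure.volume_eq_prod, Measure.prod_prod]
  simp

lemma Continuous.integrableOn_unitSquare {f : ℝ × ℝ → ℝ} (hf : Continuous f) :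
    IntegrableOn f unitSquare :=
  (hf.continuousOn.integrableOn_compact
    ((isCompact_Icc (a := (0 : ℝ)) (b := 1)).prod (isCompact_Icc (a := (0 : ℝ)) (b := 1)))).mono_set
    (prod_mono Ico_subset_Icc_self Ico_subset_Icc_self)

lemma setIntegral_unitSquare_swap (f : ℝ × ℝ → ℝ) :
    ∫ z in unitSquare, f z.swap = ∫ z in unitSquare, f z :=
  setIntegral_prod_swap (μ := (volume : Measure ℝ)) (ν := (volume : Measure ℝ)) _ _ f

lemma fderiv_eq_zero_of_notMem {u : ℝ × ℝ → ℝ} (hs : tsupport u ⊆ unitSquare) {z : ℝ × ℝ}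
    (hz : z ∉ unitSquare) : fderiv ℝ u z = 0 :=
  image_eq_zero_of_notMem_tsupport fun h => hz (hs (tsupport_fderiv_subset ℝ h))

lemma hasCompactSupport_of_tsupport_subset_unitSquare {u : ℝ × ℝ → ℝ}
    (hs : tsupport u ⊆ unitSquare) : HasCompactSupport u :=
  ((isCompact_Icc (a := (0 : ℝ)) (b := 1)).prod
    (isCompact_Icc (a := (0 : ℝ)) (b := 1))).of_isClosed_subset (isClosed_tsupport u)
    (hs.trans (prod_mono Ico_subset_Icc_self Ico_subset_Icc_self))

lemma integral_fderiv_apply_eq_zero {u : ℝ × ℝ → ℝ} (hu : ContDiff ℝ 1 u)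
    (hc : HasCompactSupport u) (v : ℝ × ℝ) : ∫ z, fderiv ℝ u z v = 0 := by
  have h := integral_bilinear_hasLineDerivAt_right_eq_neg_left_of_integrable
    (μ := (volume : Measure (ℝ × ℝ))) (f := fun _ : ℝ × ℝ => (1 : ℝ)) (f' := fun _ => 0)
    (g := u) (g' := fun z => fderiv ℝ u z v) (v := v) (B := ContinuousLinearMap.mul ℝ ℝ)
    (by simp) (by simpa using integrable_fderiv_apply_const hu hc v)
    (by simpa using hu.continuous.integrable_of_hasCompactSupport hc)
    (fun x _ => (hasFDerivAt_const (1 : ℝ) x).hasLineDerivAt v)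
    (fun x _ => ((hu.differentiable (by norm_num)) x).hasFDerivAt.hasLineDerivAt v)
  simpa using h

section
variable {u p Z : ℝ × ℝ → ℝ} {κ : ℝ}

/-- On the square `p ≤ ∂₁u + κ + Z`, and thinness bounds the integral of `∂₁u` by that of `|∂₂u| ≤
Z`. This accounts for the two copies of `∫ Z`. -/
lemma setIntegral_inter_le_of_isThin (hu : ContDiff ℝ 1 u) (hs : tsupport u ⊆ unitSquare)
    (hp : Continuous p) (hZ : Continuous Z) (hκ : 0 ≤ κ)
    (h1 : ∀ z ∈ unitSquare, |fderiv ℝ u z (1, 0) - (p z - κ)| ≤ Z z)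
    (h2 : ∀ z ∈ unitSquare, |fderiv ℝ u z (0, 1)| ≤ Z z)
    {T : Set (ℝ × ℝ)} {a : ℝ} (hT : IsThin T a) :
    ∫ z in T ∩ unitSquare, p z ≤ κ * a + 2 * ∫ z in unitSquare, Z z := by
  have hc := hasCompactSupport_of_tsupport_subset_unitSquare hs
  have iu := integrable_fderiv_apply_const hu hc (1, 0)
  have iv := (integrable_fderiv_apply_const hu hc (0, 1)).abs
  have hZ0 : ∀ z ∈ unitSquare, 0 ≤ Z z := fun z hz => (abs_nonneg _).trans (h2 z hz)
  have iZ := hZ.integrableOn_unitSquare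
  have hsub : T ∩ unitSquare ⊆ unitSquare := inter_subset_right
  have hm := hT.measurableSet.inter measurableSet_unitSquare
  have ip := hp.integrableOn_unitSquare.mono_set hsub
  have hfin : volume (T ∩ unitSquare) ≠ ⊤ :=
    ((measure_mono hsub).trans_lt (by rw [volume_unitSquare]; simp)).ne
  have e1 : ∫ z in T, fderiv ℝ u z (1, 0) = ∫ z in T ∩ unitSquare, fderiv ℝ u z (1, 0) := by
    rw [setIntegral_eq_of_subset_of_forall_sdiff_eq_zero hT.measurableSet inter_subset_left]
    intro z hz
    rw [fderiv_eq_zero_of_notMem hs fun h => hz.2 ⟨hz.1, h⟩]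
    rfl
  have e2 : ∫ z, |fderiv ℝ u z (0, 1)| = ∫ z in unitSquare, |fderiv ℝ u z (0, 1)| := by
    rw [setIntegral_eq_integral_of_forall_compl_eq_zero]
    intro z hz
    rw [fderiv_eq_zero_of_notMem hs hz]
    simp
  have b1 := hT.abs_integral_le u hu hc
  rw [e1, e2] at b1
  have b2 : ∫ z in unitSquare, |fderiv ℝ u z (0, 1)| ≤ ∫ z in unitSquare, Z z :=
    setIntegral_mono_on iv.integrableOn iZ measurableSet_unitSquare h2
  have iuκ : IntegrableOn (fun z => fderiv ℝ u z (1, 0) + κ) (T ∩ unitSquare) :=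
    iu.integrableOn.add (integrableOn_const hfin)
  have b3 : ∫ z in T ∩ unitSquare, p z ≤
      ∫ z in T ∩ unitSquare, (fderiv ℝ u z (1, 0) + κ + Z z) := by
    refine setIntegral_mono_on ip ?_ hm fun z hz => ?_
    · exact iuκ.add (iZ.mono_set hsub)
    · have := (abs_le.mp (h1 z hz.2)).1
      linarith
  have b4 : ∫ z in T ∩ unitSquare, (fderiv ℝ u z (1, 0) + κ + Z z) =
      (∫ z in T ∩ unitSquare, fderiv ℝ u z (1, 0)) + volume.real (T ∩ unitSquare) * κ +
        ∫ z in T ∩ unitSquare, Z z := by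
    rw [integral_add iuκ (iZ.mono_set hsub),
      integral_add iu.integrableOn (integrableOn_const hfin), setIntegral_const, smul_eq_mul]
  have b5 : ∫ z in T ∩ unitSquare, Z z ≤ ∫ z in unitSquare, Z z :=
    setIntegral_mono_set iZ
      (ae_restrict_of_forall_mem measurableSet_unitSquare hZ0) hsub.eventuallyLE
  have b6 := mul_le_mul_of_nonneg_right hT.area_le hκ
  have b7 := le_abs_self (∫ z in T ∩ unitSquare, fderiv ℝ u z (1, 0))
  linarith

lemma fderiv_comp_swap {v : ℝ × ℝ → ℝ} (hv : ContDiff ℝ 1 v) (z w : ℝ × ℝ) :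
    fderiv ℝ (fun z => v z.swap) z w = fderiv ℝ v z.swap w.swap := by
  have h1 : HasFDerivAt (Prod.swap : ℝ × ℝ → ℝ × ℝ)
      ((ContinuousLinearMap.snd ℝ ℝ ℝ).prod (ContinuousLinearMap.fst ℝ ℝ ℝ)) z :=
    ((ContinuousLinearMap.snd ℝ ℝ ℝ).prod (ContinuousLinearMap.fst ℝ ℝ ℝ)).hasFDerivAt
  have h2 := ((hv.differentiable (by norm_num)) z.swap).hasFDerivAt.comp z h1
  have h3 : (fun z : ℝ × ℝ => v z.swap) = v ∘ Prod.swap := rfl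
  rw [h3, h2.fderiv]
  rfl

lemma tsupport_comp_swap_subset {v : ℝ × ℝ → ℝ} (hs : tsupport v ⊆ unitSquare) :
    tsupport (fun z => v z.swap) ⊆ unitSquare := by
  refine (tsupport_comp_subset_preimage v continuous_swap).trans fun z hz => ?_
  have := hs hz
  exact ⟨this.2, this.1⟩

/-- Strips around graphs over the second axis are handled by the second component, with the
coordinates exchanged. -/
lemma setIntegral_swap_inter_le_of_isThin {v : ℝ × ℝ → ℝ} (hv : ContDiff ℝ 1 v)
    (hs : tsupport v ⊆ unitSquare)
    (hp : Continuous p) (hZ : Continuous Z) (hκ : 0 ≤ κ)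
    (h1 : ∀ z ∈ unitSquare, |fderiv ℝ v z (0, 1) - (p z - κ)| ≤ Z z)
    (h2 : ∀ z ∈ unitSquare, |fderiv ℝ v z (1, 0)| ≤ Z z)
    {T : Set (ℝ × ℝ)} {a : ℝ} (hT : IsThin T a) :
    ∫ z in Prod.swap ⁻¹' T ∩ unitSquare, p z ≤ κ * a + 2 * ∫ z in unitSquare, Z z := by
  have hsw : ∀ {z : ℝ × ℝ}, z ∈ unitSquare → z.swap ∈ unitSquare := fun h => ⟨h.2, h.1⟩
  have h := setIntegral_inter_le_of_isThin (u := fun z => v z.swap) (p := fun z => p z.swap)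
    (Z := fun z => Z z.swap) (κ := κ) (hv.comp (contDiff_snd.prodMk contDiff_fst))
    (tsupport_comp_swap_subset hs) (hp.comp continuous_swap) (hZ.comp continuous_swap) hκ
    (fun z hz => by rw [fderiv_comp_swap hv]; exact h1 _ (hsw hz))
    (fun z hz => by rw [fderiv_comp_swap hv]; exact h2 _ (hsw hz)) hT
  rw [setIntegral_unitSquare_swap] at h
  convert h using 1
  have hmp : MeasurePreserving (Prod.swap : ℝ × ℝ → ℝ × ℝ) volume volume :=
    Measure.measurePreserving_swap
  rw [← hmp.setIntegral_preimage_emb MeasurableEquiv.prodComm.measurableEmbedding]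
  congr 2
  ext z
  simp only [mem_inter_iff, mem_preimage, Prod.swap_swap]
  exact and_congr_right fun _ => ⟨fun h => hsw h, fun h => hsw h⟩

/-- Since `∂₁u` has mean zero, `∫ p ≥ κ - ∫ Z`. From above, `p` is at most `W` plus the sum of `p +
W` over the four thin pieces; as `p + W ≥ 0`, overlaps do no harm. Hence the factors `5 = 1 + 4` and
`9 = 1 + 4 * 2`. -/
lemma continuous_gap_le_of_cover {v W : ℝ × ℝ → ℝ} (hu : ContDiff ℝ 1 u)
    (hus : tsupport u ⊆ unitSquare) (hv : ContDiff ℝ 1 v) (hvs : tsupport v ⊆ unitSquare)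
    (hp : Continuous p) (hZ : Continuous Z) (hW : Continuous W) (hκ : 0 ≤ κ)
    (h1 : ∀ z ∈ unitSquare, |fderiv ℝ u z (1, 0) - (p z - κ)| ≤ Z z)
    (h2 : ∀ z ∈ unitSquare, |fderiv ℝ u z (0, 1)| ≤ Z z)
    (h3 : ∀ z ∈ unitSquare, |fderiv ℝ v z (0, 1) - (p z - κ)| ≤ Z z)
    (h4 : ∀ z ∈ unitSquare, |fderiv ℝ v z (1, 0)| ≤ Z z)
    {T₁ T₂ T₃ T₄ : Set (ℝ × ℝ)} {a : ℝ} (hT₁ : IsThin T₁ a) (hT₂ : IsThin T₂ a)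
    (hT₃ : IsThin T₃ a) (hT₄ : IsThin T₄ a)
    (hW0 : ∀ z ∈ unitSquare, 0 ≤ W z) (hpW : ∀ z ∈ unitSquare, -p z ≤ W z)
    (hcov : ∀ z ∈ unitSquare, p z ≤ W z ∨ z ∈ T₁ ∪ T₂ ∪ Prod.swap ⁻¹' (T₃ ∪ T₄)) :
    κ ≤ 5 * (∫ z in unitSquare, W z) + 4 * κ * a + 9 * ∫ z in unitSquare, Z z := by
  have hc := hasCompactSupport_of_tsupport_subset_unitSquare hus
  have iu := (integrable_fderiv_apply_const hu hc (1, 0)).integrableOn (s := unitSquare)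
  have ip := hp.integrableOn_unitSquare
  have iZ := hZ.integrableOn_unitSquare
  have iW := hW.integrableOn_unitSquare
  have hvol : volume.real unitSquare = 1 := by simp [measureReal_def, volume_unitSquare]
  have hfin : volume unitSquare ≠ ⊤ := by rw [volume_unitSquare]; simp
  have c1 : κ - ∫ z in unitSquare, Z z ≤ ∫ z in unitSquare, p z := by
    have e0 : ∫ z in unitSquare, fderiv ℝ u z (1, 0) = 0 := by
      rw [setIntegral_eq_integral_of_forall_compl_eq_zero,
        integral_fderiv_apply_eq_zero hu hc]
      intro z hz
      rw [fderiv_eq_zero_of_notMem hus hz]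
      rfl
    have iuκ : IntegrableOn (fun z => fderiv ℝ u z (1, 0) + κ) unitSquare :=
      iu.add (integrableOn_const hfin)
    have : ∫ z in unitSquare, (fderiv ℝ u z (1, 0) + κ - Z z) ≤ ∫ z in unitSquare, p z := by
      refine setIntegral_mono_on (iuκ.sub iZ) ip
        measurableSet_unitSquare fun z hz => ?_
      have := (abs_le.mp (h1 z hz)).2
      linarith
    rw [integral_sub iuκ iZ,
      integral_add iu (integrableOn_const hfin), setIntegral_const, e0, hvol] at this
    simpa using this
  have hpiece : ∀ S : Set (ℝ × ℝ), MeasurableSet S →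
      ∫ z in S ∩ unitSquare, p z ≤ κ * a + 2 * (∫ z in unitSquare, Z z) →
      IntegrableOn (S.indicator fun z => p z + W z) unitSquare ∧
      ∫ z in unitSquare, S.indicator (fun z => p z + W z) z ≤
        κ * a + 2 * (∫ z in unitSquare, Z z) + ∫ z in unitSquare, W z := by
    intro S hS h
    refine ⟨(ip.add iW).indicator hS, ?_⟩
    rw [integral_indicator hS, Measure.restrict_restrict hS, integral_add
      (ip.mono_set inter_subset_right) (iW.mono_set inter_subset_right)]
    refine add_le_add h ?_
    exact setIntegral_mono_set iW
      (ae_restrict_of_forall_mem measurableSet_unitSquare hW0) inter_subset_right.eventuallyLE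
  obtain ⟨i1, b1⟩ := hpiece T₁ hT₁.measurableSet
    (setIntegral_inter_le_of_isThin hu hus hp hZ hκ h1 h2 hT₁)
  obtain ⟨i2, b2⟩ := hpiece T₂ hT₂.measurableSet
    (setIntegral_inter_le_of_isThin hu hus hp hZ hκ h1 h2 hT₂)
  obtain ⟨i3, b3⟩ := hpiece (Prod.swap ⁻¹' T₃) (measurable_swap hT₃.measurableSet)
    (setIntegral_swap_inter_le_of_isThin hv hvs hp hZ hκ h3 h4 hT₃)
  obtain ⟨i4, b4⟩ := hpiece (Prod.swap ⁻¹' T₄) (measurable_swap hT₄.measurableSet)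
    (setIntegral_swap_inter_le_of_isThin hv hvs hp hZ hκ h3 h4 hT₄)
  have c2 : ∫ z in unitSquare, p z ≤ ∫ z in unitSquare, (W z +
      (T₁.indicator (fun z => p z + W z) z + T₂.indicator (fun z => p z + W z) z +
      ((Prod.swap ⁻¹' T₃).indicator (fun z => p z + W z) z +
      (Prod.swap ⁻¹' T₄).indicator (fun z => p z + W z) z))) := by
    refine setIntegral_mono_on ip (iW.add ((i1.add i2).add (i3.add i4)))
      measurableSet_unitSquare fun z hz => ?_
    have hnn : 0 ≤ p z + W z := by linarith [hpW z hz]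
    have hind : ∀ S : Set (ℝ × ℝ), 0 ≤ S.indicator (fun z => p z + W z) z := fun S => by
      by_cases h : z ∈ S
      · rwa [indicator_of_mem h]
      · rw [indicator_of_notMem h]
    have hin : ∀ S : Set (ℝ × ℝ), z ∈ S →
        S.indicator (fun z => p z + W z) z = p z + W z := fun S h => indicator_of_mem h _
    have g1 := hind T₁
    have g2 := hind T₂
    have g3 := hind (Prod.swap ⁻¹' T₃)
    have g4 := hind (Prod.swap ⁻¹' T₄)
    have gW := hW0 z hz
    rcases hcov z hz with h | (h | h) | (h | h)
    · linarith
    · linarith [hin _ h]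
    · linarith [hin _ h]
    · linarith [hin (Prod.swap ⁻¹' T₃) h]
    · linarith [hin (Prod.swap ⁻¹' T₄) h]
  have i12 : IntegrableOn (fun z => T₁.indicator (fun z => p z + W z) z +
      T₂.indicator (fun z => p z + W z) z) unitSquare := i1.add i2
  have i34 : IntegrableOn (fun z => (Prod.swap ⁻¹' T₃).indicator (fun z => p z + W z) z +
      (Prod.swap ⁻¹' T₄).indicator (fun z => p z + W z) z) unitSquare := i3.add i4
  have i14 : IntegrableOn (fun z => T₁.indicator (fun z => p z + W z) z +
      T₂.indicator (fun z => p z + W z) z + ((Prod.swap ⁻¹' T₃).indicator (fun z => p z + W z) z +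
      (Prod.swap ⁻¹' T₄).indicator (fun z => p z + W z) z)) unitSquare := i12.add i34
  rw [integral_add iW i14, integral_add i12 i34,
    integral_add i1 i2, integral_add i3 i4] at c2
  linarith

end

lemma gridCell_subset_unitSquare {N : ℕ} (hN : 0 < N) {p : ℤ × ℤ}
    (hp : p ∈ Finset.Ico (0 : ℤ) N ×ˢ Finset.Ico (0 : ℤ) N) :
    gridCell (1 / N) p ⊆ unitSquare := by
  have hN' : (0 : ℝ) < N := by exact_mod_cast hN
  simp only [Finset.mem_product, Finset.mem_Ico] at hp
  have key : ∀ i : ℤ, 0 ≤ i → i < N → Ico ((i : ℝ) * (1 / N)) ((i + 1) * (1 / N)) ⊆ Ico 0 1 := by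
    intro i h0 h1
    refine Ico_subset_Ico ?_ ?_
    · have : (0 : ℝ) ≤ i := by exact_mod_cast h0
      positivity
    · have : (i : ℝ) + 1 ≤ N := by exact_mod_cast h1
      rw [mul_one_div, div_le_one hN']
      exact this
  exact prod_mono (key _ hp.1.1 hp.1.2) (key _ hp.2.1 hp.2.2)

lemma mem_gridCell_floor {w : ℝ} (hw : 0 < w) (z : ℝ × ℝ) :
    z ∈ gridCell w (⌊z.1 / w⌋, ⌊z.2 / w⌋) := by
  refine ⟨⟨?_, ?_⟩, ?_, ?_⟩ <;> simp only
  · rw [← le_div_iff₀ hw]; exact Int.floor_le _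
  · rw [← div_lt_iff₀ hw]; exact Int.lt_floor_add_one _
  · rw [← le_div_iff₀ hw]; exact Int.floor_le _
  · rw [← div_lt_iff₀ hw]; exact Int.lt_floor_add_one _

lemma eq_floor_of_mem_gridCell {w : ℝ} (hw : 0 < w) {z : ℝ × ℝ} {p : ℤ × ℤ}
    (h : z ∈ gridCell w p) : p = (⌊z.1 / w⌋, ⌊z.2 / w⌋) := by
  obtain ⟨⟨h1, h2⟩, h3, h4⟩ := h
  refine Prod.ext (Eq.symm (Int.floor_eq_iff.mpr ⟨?_, ?_⟩))
    (Eq.symm (Int.floor_eq_iff.mpr ⟨?_, ?_⟩))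
  · rwa [le_div_iff₀ hw]
  · rwa [div_lt_iff₀ hw]
  · rwa [le_div_iff₀ hw]
  · rwa [div_lt_iff₀ hw]

lemma volume_real_gridCell {w : ℝ} (hw : 0 < w) (p : ℤ × ℤ) :
    volume.real (gridCell w p) = w ^ 2 := by
  rw [gridCell, measureReal_def, Measure.volume_eq_prod, Measure.prod_prod, Real.volume_Ico,
    Real.volume_Ico, ← ENNReal.ofReal_mul (by nlinarith), ENNReal.toReal_ofReal]
  · ring
  · ring_nf
    positivity

/-- The superlevel set of a continuous function is covered by thin sets whose area is controlled
by the measure of a lower superlevel set. -/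
lemma exists_isThin_cover_superlevel {E r : ℝ × ℝ → ℝ} (hE : Continuous E) (hr : Continuous r)
    {ρ m : ℝ} (hρ : 0 < ρ) (hm : 0 < m) (hE0 : ∀ z ∈ unitSquare, 0 ≤ E z)
    (hEm : ∀ z ∈ unitSquare, ρ ≤ r z → m ≤ E z) :
    ∃ a : ℝ, a ≤ √((∫ z in unitSquare, E z) / m) ∧ ∃ T₁ T₂ T₃ T₄ : Set (ℝ × ℝ),
      IsThin T₁ a ∧ IsThin T₂ a ∧ IsThin T₃ a ∧ IsThin T₄ a ∧
      ∀ z ∈ unitSquare, 2 * ρ ≤ r z → z ∈ T₁ ∪ T₂ ∪ Prod.swap ⁻¹' (T₃ ∪ T₄) := by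
  classical
  have hQc : IsCompact (Icc (0 : ℝ) 1 ×ˢ Icc (0 : ℝ) 1) := isCompact_Icc.prod isCompact_Icc
  have hQ : unitSquare ⊆ Icc (0 : ℝ) 1 ×ˢ Icc (0 : ℝ) 1 :=
    prod_mono Ico_subset_Icc_self Ico_subset_Icc_self
  -- The mesh is so fine that `r` varies by less than `ρ` on a cell: a cell meeting `{2ρ ≤ r}` lies
  -- in `{ρ ≤ r}`, where `E ≥ m`. The integral of `E` thus bounds the number of such cells.
  obtain ⟨δ, hδ, huc⟩ := Metric.uniformContinuousOn_iff.mp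
    (hQc.uniformContinuousOn_of_continuous hr.continuousOn) ρ hρ
  obtain ⟨n, hn⟩ := exists_nat_one_div_lt hδ
  set N := n + 1 with hNdef
  have hN : 0 < N := by omega
  have hN' : (0 : ℝ) < N := by exact_mod_cast hN
  have hNδ : (1 : ℝ) / N < δ := by rw [hNdef]; push_cast; exact hn
  set w : ℝ := 1 / N with hw
  have hw0 : 0 < w := by positivity
  set B := (Finset.Ico (0 : ℤ) N ×ˢ Finset.Ico (0 : ℤ) N).filter
    fun p => ∃ z ∈ gridCell w p, 2 * ρ ≤ r z with hB
  have hBsub : ∀ p ∈ B, gridCell w p ⊆ unitSquare := fun p hp =>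
    gridCell_subset_unitSquare hN (Finset.mem_filter.mp hp).1
  have hBE : ∀ p ∈ B, ∀ z ∈ gridCell w p, m ≤ E z := by
    intro p hp z hz
    obtain ⟨z', hz', hrz⟩ := (Finset.mem_filter.mp hp).2
    refine hEm z (hBsub p hp hz) ?_
    have hd : dist z z' < δ := by
      refine lt_of_le_of_lt ?_ hNδ
      rw [Prod.dist_eq, Real.dist_eq, Real.dist_eq]
      obtain ⟨⟨a1, a2⟩, a3, a4⟩ := hz
      obtain ⟨⟨b1, b2⟩, b3, b4⟩ := hz'
      refine max_le (abs_le.mpr ⟨?_, ?_⟩) (abs_le.mpr ⟨?_, ?_⟩) <;> linarith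
    have := huc z (hQ (hBsub p hp hz)) z' (hQ (hBsub p hp hz')) hd
    rw [Real.dist_eq] at this
    have := (abs_lt.mp this).1
    linarith
  have hcm : ∀ p, MeasurableSet (gridCell w p) := fun p =>
    measurableSet_Ico.prod measurableSet_Ico
  have hdisj : Pairwise (Function.onFun Disjoint (gridCell w)) := by
    intro p q hpq
    rw [Function.onFun, Set.disjoint_left]
    intro z hz hz'
    exact hpq ((eq_floor_of_mem_gridCell hw0 hz).trans (eq_floor_of_mem_gridCell hw0 hz').symm)
  have iE := hE.integrableOn_unitSquare
  have harea : (B.card : ℝ) * (w ^ 2 * m) ≤ ∫ z in unitSquare, E z := by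
    calc (B.card : ℝ) * (w ^ 2 * m) = ∑ p ∈ B, w ^ 2 * m := by simp
      _ ≤ ∑ p ∈ B, ∫ z in gridCell w p, E z := by
          refine Finset.sum_le_sum fun p hp => ?_
          have hfin : volume (gridCell w p) ≠ ⊤ :=
            ((measure_mono (hBsub p hp)).trans_lt (by rw [volume_unitSquare]; simp)).ne
          rw [← volume_real_gridCell hw0 p, ← smul_eq_mul, ← setIntegral_const]
          exact setIntegral_mono_on (integrableOn_const hfin) (iE.mono_set (hBsub p hp)) (hcm p)
            (hBE p hp)
      _ = ∫ z in ⋃ p ∈ B, gridCell w p, E z :=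
          (integral_biUnion_finset _ (fun p _ => hcm p) (hdisj.set_pairwise _)
            fun p hp => iE.mono_set (hBsub p hp)).symm
      _ ≤ ∫ z in unitSquare, E z :=
          setIntegral_mono_set iE (ae_restrict_of_forall_mem measurableSet_unitSquare hE0)
            (iUnion₂_subset hBsub).eventuallyLE
  -- Balanced choice: steep chains in `B₁` and flat chains in `B₂` both have at most `√|B|` points,
  -- so each thin set has area at most `√|B| * w`.
  set k := Nat.sqrt B.card with hk
  obtain ⟨B₁, B₂, hBB, hB₁, hB₂⟩ := exists_split_steep_flat k B
  obtain ⟨T₁, T₂, hT₁, hT₂, hT⟩ := exists_isThin_cover hB₁ hw0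
  obtain ⟨T₃, T₄, hT₃, hT₄, hT'⟩ := exists_isThin_cover (k := k) (B := B₂.image Prod.swap) (by
    intro C hC hs
    have hC' : C.image Prod.swap ⊆ B₂ := by
      intro x hx
      obtain ⟨y, hy, rfl⟩ := Finset.mem_image.mp hx
      obtain ⟨x', hx', hxy⟩ := Finset.mem_image.mp (hC hy)
      rw [← hxy, Prod.swap_swap]
      exact hx'
    have hflat : IsFlatChain (C.image Prod.swap) := by
      intro p hp q hq hpq
      obtain ⟨p', hp', rfl⟩ := Finset.mem_image.mp hp
      obtain ⟨q', hq', rfl⟩ := Finset.mem_image.mp hq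
      exact hs p' hp' q' hq' fun h => hpq (by rw [h])
    have h1 := hB₂ _ hC' hflat
    rw [Finset.card_image_of_injective _ Prod.swap_injective] at h1
    by_contra hcon
    push Not at hcon
    have h2 := Nat.sqrt_lt'.mp (show Nat.sqrt B.card < k + 1 by omega)
    nlinarith) hw0
  refine ⟨k * w, ?_, T₁, T₂, T₃, T₄, hT₁, hT₂, hT₃, hT₄, ?_⟩
  · refine Real.le_sqrt_of_sq_le ?_
    rw [le_div_iff₀ hm]
    refine le_trans ?_ harea
    have : ((k ^ 2 : ℕ) : ℝ) ≤ B.card := by exact_mod_cast Nat.sqrt_le' B.card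
    push_cast at this
    have h3 : 0 ≤ w ^ 2 * m := by positivity
    calc (k * w) ^ 2 * m = (k : ℝ) ^ 2 * (w ^ 2 * m) := by ring
      _ ≤ _ := mul_le_mul_of_nonneg_right this h3
  · intro z hz hrz
    have hcell := mem_gridCell_floor hw0 z
    set p : ℤ × ℤ := (⌊z.1 / w⌋, ⌊z.2 / w⌋) with hp
    have hfl : ∀ t : ℝ, t ∈ Ico (0 : ℝ) 1 → ⌊t / w⌋ ∈ Finset.Ico (0 : ℤ) N := by
      intro t ht
      rw [Finset.mem_Ico, Int.floor_nonneg, Int.floor_lt]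
      refine ⟨div_nonneg ht.1 hw0.le, ?_⟩
      rw [div_lt_iff₀ hw0, hw]
      push_cast
      rw [mul_one_div_cancel hN'.ne']
      exact ht.2
    have hpB : p ∈ B := Finset.mem_filter.mpr
      ⟨Finset.mem_product.mpr ⟨hfl _ hz.1, hfl _ hz.2⟩, z, hcell, hrz⟩
    rcases Finset.mem_union.mp (hBB hpB) with h | h
    · exact Or.inl (hT p h hcell)
    · exact Or.inr (hT' p.swap (Finset.mem_image_of_mem _ h) ⟨hcell.2, hcell.1⟩)

/-- A quantitative rigidity estimate: if the gradient of `(u, v)` is close to a multiple of the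
identity, up to an error controlled by `E`, then the multiple cannot be close to `-κ` most of the
time. -/
lemma exists_le_setIntegral_of_gap {κ m ρ c : ℝ} (hκ : 0 < κ) (hm : 0 < m) (hρ : 0 < ρ)
    {σ C₁ C₂ : ℝ} (hσ : 0 ≤ σ) (hσ2 : σ ≤ 1 / 2) (hσκ : 18 * σ * (κ + c) ≤ κ / 8)
    (hC₁ : 0 ≤ C₁) (hC₂ : 0 ≤ C₂) :
    ∃ θ > 0, ∀ u v p Z E r : ℝ × ℝ → ℝ, ContDiff ℝ 1 u → ContDiff ℝ 1 v →
      tsupport u ⊆ unitSquare → tsupport v ⊆ unitSquare →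
      Continuous p → Continuous Z → Continuous E → Continuous r →
      (∀ z, |fderiv ℝ u z (1, 0) - (p z - κ)| ≤ Z z) →
      (∀ z, |fderiv ℝ u z (0, 1)| ≤ Z z) →
      (∀ z, |fderiv ℝ v z (0, 1) - (p z - κ)| ≤ Z z) →
      (∀ z, |fderiv ℝ v z (1, 0)| ≤ Z z) →
      (∀ z, 0 ≤ E z) → (∀ z, ρ ≤ r z → m ≤ E z) →
      (∀ z, -p z ≤ κ / 40 + C₁ * E z) → (∀ z, r z ≤ 2 * ρ → p z ≤ κ / 40 + C₁ * E z) →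
      (∀ z, Z z ≤ σ * (p z + c) + C₂ * E z) →
      θ ≤ ∫ z in unitSquare, E z := by
  set K := 5 * C₁ + 18 * C₂ + 1 with hK
  have hK0 : 0 < K := by positivity
  -- Below this value the area parameter is at most `√(1/256) = 1/16`, and the terms of the gap
  -- inequality are at most `κ/8` from `W`, `κ/4` from the area, `κ/8` from `σ` and `κ/8` from `E`,
  -- which add up to less than `κ`.
  refine ⟨min (κ / (8 * K)) (m / 256), by positivity, ?_⟩
  intro u v p Z E r hu hv hus hvs hp hZ hE hr h1 h2 h3 h4 hE0 hEm hpn hpr hZE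
  by_contra hcon
  push Not at hcon
  set Ē := ∫ z in unitSquare, E z with hĒ
  have iE := hE.integrableOn_unitSquare
  have ip := hp.integrableOn_unitSquare
  have iZ := hZ.integrableOn_unitSquare
  have iu := (integrable_fderiv_apply_const hu
    (hasCompactSupport_of_tsupport_subset_unitSquare hus) (1, 0)).integrableOn (s := unitSquare)
  have hĒ0 : 0 ≤ Ē := integral_nonneg hE0
  have hfin : volume unitSquare ≠ ⊤ := by rw [volume_unitSquare]; simp
  have hvol : volume.real unitSquare = 1 := by simp [measureReal_def, volume_unitSquare]
  obtain ⟨a, ha, T₁, T₂, T₃, T₄, hT₁, hT₂, hT₃, hT₄, hcov⟩ :=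
    exists_isThin_cover_superlevel hE hr hρ hm (fun z _ => hE0 z) (fun z _ => hEm z)
  have hmain := continuous_gap_le_of_cover (W := fun z => κ / 40 + C₁ * E z) hu hus hv hvs hp hZ
    (by fun_prop) hκ.le (fun z _ => h1 z) (fun z _ => h2 z) (fun z _ => h3 z) (fun z _ => h4 z)
    hT₁ hT₂ hT₃ hT₄ (fun z _ => by have := hE0 z; positivity) (fun z _ => hpn z)
    (fun z hz => (le_total (r z) (2 * ρ)).elim (fun h => Or.inl (hpr z h))
      fun h => Or.inr (hcov z hz h))
  have eW : ∫ z in unitSquare, (κ / 40 + C₁ * E z) = κ / 40 + C₁ * Ē := by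
    have iκ : IntegrableOn (fun _ : ℝ × ℝ => κ / 40) unitSquare := integrableOn_const hfin
    rw [integral_add iκ (iE.const_mul C₁), setIntegral_const, hvol, integral_const_mul, one_smul]
  have hpκ : ∫ z in unitSquare, p z ≤ κ + ∫ z in unitSquare, Z z := by
    have e0 : ∫ z in unitSquare, fderiv ℝ u z (1, 0) = 0 := by
      rw [setIntegral_eq_integral_of_forall_compl_eq_zero, integral_fderiv_apply_eq_zero hu
        (hasCompactSupport_of_tsupport_subset_unitSquare hus)]
      intro z hz
      rw [fderiv_eq_zero_of_notMem hus hz]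
      rfl
    have iuκ : IntegrableOn (fun z => fderiv ℝ u z (1, 0) + κ) unitSquare :=
      iu.add (integrableOn_const hfin)
    have : ∫ z in unitSquare, p z ≤ ∫ z in unitSquare, (fderiv ℝ u z (1, 0) + κ + Z z) := by
      refine setIntegral_mono_on ip (iuκ.add iZ)
        measurableSet_unitSquare fun z _ => ?_
      have := (abs_le.mp (h1 z)).1
      linarith
    rw [integral_add iuκ iZ,
      integral_add iu (integrableOn_const hfin), setIntegral_const, e0, hvol] at this
    simpa using this
  have hZi : ∫ z in unitSquare, Z z ≤ σ * (∫ z in unitSquare, p z) + σ * c + C₂ * Ē := by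
    have ipc : IntegrableOn (fun z => p z + c) unitSquare := ip.add (integrableOn_const hfin)
    have : ∫ z in unitSquare, Z z ≤ ∫ z in unitSquare, (σ * (p z + c) + C₂ * E z) :=
      setIntegral_mono_on iZ ((ipc.const_mul σ).add (iE.const_mul C₂)) measurableSet_unitSquare fun z _ => hZE z
    rw [integral_add (ipc.const_mul σ) (iE.const_mul C₂),
      integral_const_mul, integral_const_mul, integral_add ip (integrableOn_const hfin),
      setIntegral_const, hvol, one_smul] at this
    linarith
  rw [eW] at hmain
  have hZ0 : 0 ≤ ∫ z in unitSquare, Z z := integral_nonneg fun z => (abs_nonneg _).trans (h2 z)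
  -- `∫ p` is itself controlled by `κ + ∫ Z`; as `σ ≤ 1/2`, the resulting `σ ∫ Z` is absorbed on the
  -- left.
  have hZ2 : ∫ z in unitSquare, Z z ≤ 2 * σ * (κ + c) + 2 * C₂ * Ē := by
    have := mul_le_mul_of_nonneg_left hpκ hσ
    have := mul_le_mul_of_nonneg_right hσ2 hZ0
    linarith
  have ha2 : a ≤ 1 / 16 := by
    refine ha.trans (Real.sqrt_le_iff.mpr ⟨by norm_num, ?_⟩)
    rw [div_le_iff₀ hm]
    have := hcon.le.trans (min_le_right _ _)
    linarith
  have ha3 : 4 * κ * a ≤ κ / 4 := by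
    have := mul_le_mul_of_nonneg_left ha2 hκ.le
    linarith
  have hEK : K * Ē ≤ κ / 8 := by
    have := hcon.le.trans (min_le_left _ _)
    rw [le_div_iff₀ (by positivity)] at this
    linarith
  have : K * Ē = 5 * C₁ * Ē + 18 * C₂ * Ē + Ē := by rw [hK]; ring
  linarith

/-! ### The Frobenius inner product and the convex envelope -/

section Frobenius
variable {m n : ℕ}

/-- The Frobenius inner product of two matrices. -/
def frobInner (A B : Matrix (Fin m) (Fin n) ℝ) : ℝ := ∑ i, ∑ j, A i j * B i j

lemma frobenius_norm_sq (A : Matrix (Fin m) (Fin n) ℝ) : ‖A‖ ^ 2 = ∑ i, ∑ j, A i j ^ 2 := by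
  have h0 : 0 ≤ ∑ i, ∑ j, A i j ^ 2 := by positivity
  rw [Matrix.frobenius_norm_def]
  simp only [Real.norm_eq_abs]
  norm_cast
  simp only [sq_abs]
  rw [← Real.sqrt_eq_rpow, Real.sq_sqrt h0]

lemma frobInner_self (A : Matrix (Fin m) (Fin n) ℝ) : frobInner A A = ‖A‖ ^ 2 := by
  rw [frobenius_norm_sq]
  simp [frobInner, sq]

lemma frobInner_add (A B C : Matrix (Fin m) (Fin n) ℝ) :
    frobInner A (B + C) = frobInner A B + frobInner A C := by
  simp [frobInner, mul_add, Finset.sum_add_distrib]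

lemma frobInner_sub (A B C : Matrix (Fin m) (Fin n) ℝ) :
    frobInner A (B - C) = frobInner A B - frobInner A C := by
  simp [frobInner, mul_sub, Finset.sum_sub_distrib]

lemma frobInner_smul (A B : Matrix (Fin m) (Fin n) ℝ) (c : ℝ) :
    frobInner A (c • B) = c * frobInner A B := by
  simp only [frobInner, Matrix.smul_apply, smul_eq_mul, Finset.mul_sum]
  exact Finset.sum_congr rfl fun i _ => Finset.sum_congr rfl fun j _ => by ring

lemma frobInner_comm (A B : Matrix (Fin m) (Fin n) ℝ) : frobInner A B = frobInner B A := by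
  simp only [frobInner, mul_comm]

lemma frobenius_norm_smul (c : ℝ) (A : Matrix (Fin m) (Fin n) ℝ) : ‖c • A‖ = |c| * ‖A‖ := by
  have h : ‖c • A‖ ^ 2 = (|c| * ‖A‖) ^ 2 := by
    rw [← frobInner_self, frobInner_smul, frobInner_comm, frobInner_smul, frobInner_self, mul_pow,
      sq_abs]
    ring
  exact (sq_eq_sq₀ (norm_nonneg _) (by positivity)).mp h

lemma frobInner_le (A B : Matrix (Fin m) (Fin n) ℝ) : frobInner A B ≤ ‖A‖ * ‖B‖ := by
  refine Real.le_sqrt_of_sq_le (y := (‖A‖ * ‖B‖) ^ 2) ?_ |>.trans_eq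
    (Real.sqrt_sq (by positivity))
  rw [mul_pow, frobenius_norm_sq, frobenius_norm_sq, frobInner, ← Finset.sum_product',
    ← Finset.sum_product', ← Finset.sum_product']
  exact Finset.sum_mul_sq_le_sq_mul_sq _ _ _

lemma neg_le_frobInner (A B : Matrix (Fin m) (Fin n) ℝ) : -(‖A‖ * ‖B‖) ≤ frobInner A B := by
  have h := frobInner_le A ((-1 : ℝ) • B)
  rw [frobInner_smul, frobenius_norm_smul] at h
  simp only [abs_neg, abs_one, one_mul] at h
  linarith

lemma abs_apply_le_frobenius_norm (A : Matrix (Fin m) (Fin n) ℝ) (i : Fin m) (j : Fin n) :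
    |A i j| ≤ ‖A‖ := by
  refine abs_le_of_sq_le_sq ?_ (norm_nonneg _)
  rw [frobenius_norm_sq]
  refine le_trans ?_ (Finset.single_le_sum (f := fun i => ∑ j, A i j ^ 2)
    (fun i _ => by positivity) (Finset.mem_univ i))
  exact Finset.single_le_sum (f := fun j => A i j ^ 2) (fun j _ => by positivity)
    (Finset.mem_univ j)

lemma continuous_frobenius_norm {X : Type*} [TopologicalSpace X]
    {A : X → Matrix (Fin m) (Fin n) ℝ} (hA : ∀ i j, Continuous fun x => A x i j) :
    Continuous fun x => ‖A x‖ := by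
  have : (fun x => ‖A x‖) = fun x => √(∑ i, ∑ j, A x i j ^ 2) := by
    funext x
    rw [← frobenius_norm_sq, Real.sqrt_sq (norm_nonneg _)]
  rw [this]
  exact Real.continuous_sqrt.comp
    (continuous_finsetSum _ fun i _ => continuous_finsetSum _ fun j _ => (hA i j).pow 2)

lemma continuous_frobInner {X : Type*} [TopologicalSpace X] (N : Matrix (Fin m) (Fin n) ℝ)
    {A : X → Matrix (Fin m) (Fin n) ℝ} (hA : ∀ i j, Continuous fun x => A x i j) :
    Continuous fun x => frobInner N (A x) :=
  continuous_finsetSum _ fun i _ => continuous_finsetSum _ fun j _ =>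
    continuous_const.mul (hA i j)

lemma continuous_hSimp {X : Type*} [TopologicalSpace X] (ℓ : ℝ)
    {A : X → Matrix (Fin m) (Fin n) ℝ} (hA : ∀ i j, Continuous fun x => A x i j) :
    Continuous fun x => hSimp m n ℓ (A x) :=
  ((continuous_frobenius_norm hA).pow 2).min (continuous_const.mul (continuous_frobenius_norm hA))

end Frobenius

/-! ### The convex envelope as a Huber function -/

/-- The radial profile of the convex envelope of `t ↦ min (t ^ 2) (ℓ * t)`. -/
noncomputable def huber (ℓ t : ℝ) : ℝ := if t ≤ ℓ / 2 then t ^ 2 else ℓ * t - ℓ ^ 2 / 4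

/-- The subgradient of the Huber function of the norm. -/
noncomputable def huberSlope {m n : ℕ} (ℓ : ℝ) (ξ : Matrix (Fin m) (Fin n) ℝ) : Matrix (Fin m) (Fin n) ℝ :=
  if ‖ξ‖ ≤ ℓ / 2 then (2 : ℝ) • ξ else (ℓ * ‖ξ‖⁻¹) • ξ

section Envelope
variable {m n : ℕ} {ℓ : ℝ}

lemma hSimp_nonneg (hℓ : 0 < ℓ) (ξ : Matrix (Fin m) (Fin n) ℝ) : 0 ≤ hSimp m n ℓ ξ :=
  le_min (by positivity) (by positivity)

lemma hSimp_eq_sq (ξ : Matrix (Fin m) (Fin n) ℝ) (h : ‖ξ‖ ≤ ℓ) :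
    hSimp m n ℓ ξ = ‖ξ‖ ^ 2 :=
  min_eq_left (by nlinarith [norm_nonneg ξ])

lemma sub_le_hSimp (ξ : Matrix (Fin m) (Fin n) ℝ) : ℓ * ‖ξ‖ - ℓ ^ 2 / 4 ≤ hSimp m n ℓ ξ :=
  le_min (by nlinarith [sq_nonneg (‖ξ‖ - ℓ / 2)]) (by nlinarith [sq_nonneg ℓ])

/-- The Huber function of the norm has a supporting affine function below `h`. -/
lemma huber_add_frobInner_le_hSimp (hℓ : 0 < ℓ) (ξ η : Matrix (Fin m) (Fin n) ℝ) :
    huber ℓ ‖ξ‖ + frobInner (huberSlope ℓ ξ) (η - ξ) ≤ hSimp m n ℓ η := by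
  have hη := norm_nonneg η
  have hξ := norm_nonneg ξ
  rw [frobInner_sub]
  by_cases h : ‖ξ‖ ≤ ℓ / 2
  · rw [huber, huberSlope, if_pos h, if_pos h, frobInner_comm, frobInner_comm _ ξ, frobInner_smul,
      frobInner_smul, frobInner_self, frobInner_comm]
    have h1 := frobInner_le ξ η
    refine le_min ?_ ?_
    · nlinarith [sq_nonneg (‖ξ‖ - ‖η‖)]
    · nlinarith
  · rw [huber, huberSlope, if_neg h, if_neg h, frobInner_comm, frobInner_comm _ ξ, frobInner_smul,
      frobInner_smul, frobInner_self, frobInner_comm]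
    push Not at h
    have hξ0 : 0 < ‖ξ‖ := by linarith
    refine le_trans ?_ (sub_le_hSimp η)
    have h1 := frobInner_le ξ η
    have h2 : ‖ξ‖⁻¹ * frobInner ξ η ≤ ‖η‖ := by
      rw [inv_mul_le_iff₀ hξ0]
      exact h1
    have h3 : ℓ * ‖ξ‖⁻¹ * ‖ξ‖ ^ 2 = ℓ * ‖ξ‖ := by
      field_simp
    rw [h3, mul_assoc]
    nlinarith

lemma bddAbove_convEnvelope (ξ : Matrix (Fin m) (Fin n) ℝ) :
    BddAbove {r : ℝ | ∃ g : Matrix (Fin m) (Fin n) ℝ → ℝ,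
      ConvexOn ℝ univ g ∧ (∀ η, g η ≤ hSimp m n ℓ η) ∧ r = g ξ} :=
  ⟨hSimp m n ℓ ξ, by rintro _ ⟨g, _, hg, rfl⟩; exact hg ξ⟩

lemma huber_le_convEnvelope (hℓ : 0 < ℓ) (ξ : Matrix (Fin m) (Fin n) ℝ) :
    huber ℓ ‖ξ‖ ≤ convEnvelope (hSimp m n ℓ) ξ := by
  refine le_csSup (bddAbove_convEnvelope ξ)
    ⟨fun η => huber ℓ ‖ξ‖ + frobInner (huberSlope ℓ ξ) (η - ξ), ?_,
      huber_add_frobInner_le_hSimp hℓ ξ, ?_⟩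
  · refine ⟨convex_univ, fun x _ y _ a b _ _ hab => le_of_eq ?_⟩
    simp only [frobInner_sub, frobInner_add, frobInner_smul, smul_eq_mul]
    rw [← eq_sub_iff_add_eq] at hab
    rw [hab]
    ring
  · simp [frobInner]

/-- A convex function below `h` is below the Huber function of the norm. -/
lemma le_huber_of_convexOn (hℓ : 0 < ℓ) {g : Matrix (Fin m) (Fin n) ℝ → ℝ}
    (hg : ConvexOn ℝ univ g) (hgh : ∀ η, g η ≤ hSimp m n ℓ η) (ξ : Matrix (Fin m) (Fin n) ℝ) :
    g ξ ≤ huber ℓ ‖ξ‖ := by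
  by_cases h : ‖ξ‖ ≤ ℓ / 2
  · rw [huber, if_pos h]
    exact (hgh ξ).trans (min_le_left _ _)
  · rw [huber, if_neg h]
    push Not at h
    have hξ0 : 0 < ‖ξ‖ := by linarith
    -- Split `ξ` along its ray into `c • ξ` of norm `ℓ / 2` and `d • ξ` with weight `t`; then `t →
    -- 0` sends `d` to infinity.
    have key : ∀ t : ℝ, t ∈ Ioo (0 : ℝ) 1 → g ξ ≤ ℓ * ‖ξ‖ - (1 - t) * ℓ ^ 2 / 4 := by
      rintro t ⟨ht0, ht1⟩
      set c := ℓ / (2 * ‖ξ‖) with hc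
      have hc0 : 0 < c := by positivity
      have hcξ : c * ‖ξ‖ = ℓ / 2 := by rw [hc]; field_simp
      have hc1 : c < 1 := by rw [hc, div_lt_one (by positivity)]; linarith
      set d := (1 - (1 - t) * c) / t with hd
      have hd0 : 0 < d := div_pos (by nlinarith) ht0
      have hcomb : (1 - t) • (c • ξ) + t • (d • ξ) = ξ := by
        rw [smul_smul, smul_smul, ← add_smul]
        have : (1 - t) * c + t * d = 1 := by rw [hd]; field_simp; ring
        rw [this, one_smul]
      have h1 := hg.2 (mem_univ (c • ξ)) (mem_univ (d • ξ)) (by linarith : 0 ≤ 1 - t) ht0.le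
        (by ring)
      rw [hcomb, smul_eq_mul, smul_eq_mul] at h1
      have h2 : g (c • ξ) ≤ ℓ ^ 2 / 4 := by
        refine ((hgh _).trans (min_le_left _ _)).trans_eq ?_
        rw [frobenius_norm_smul, abs_of_pos hc0, hcξ]
        ring
      have h3 : g (d • ξ) ≤ ℓ * (d * ‖ξ‖) := by
        refine ((hgh _).trans (min_le_right _ _)).trans_eq ?_
        rw [frobenius_norm_smul, abs_of_pos hd0]
      have h4 : t * (ℓ * (d * ‖ξ‖)) = ℓ * ‖ξ‖ - (1 - t) * ℓ ^ 2 / 2 := by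
        have : t * (ℓ * (d * ‖ξ‖)) = ℓ * ‖ξ‖ - (1 - t) * ℓ * (c * ‖ξ‖) := by
          rw [hd]; field_simp
        rw [this, hcξ]; ring
      have h5 := mul_le_mul_of_nonneg_left h2 (by linarith : 0 ≤ 1 - t)
      have h6 := mul_le_mul_of_nonneg_left h3 ht0.le
      linarith
    refine le_of_forall_pos_le_add fun ε hε => ?_
    have hℓ2 : 0 < ℓ ^ 2 := by positivity
    have hm : 0 < min (1 / 2) (ε / ℓ ^ 2) := by positivity
    have h1 := key (min (1 / 2) (ε / ℓ ^ 2)) ⟨hm, (min_le_left _ _).trans_lt (by norm_num)⟩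
    have h2 : min (1 / 2) (ε / ℓ ^ 2) * ℓ ^ 2 ≤ ε := by
      rw [← le_div_iff₀ hℓ2]
      exact min_le_right _ _
    linarith

lemma convEnvelope_hSimp (hℓ : 0 < ℓ) (ξ : Matrix (Fin m) (Fin n) ℝ) :
    convEnvelope (hSimp m n ℓ) ξ = huber ℓ ‖ξ‖ := by
  refine le_antisymm (csSup_le ⟨0, fun _ => 0, convexOn_const _ convex_univ,
    hSimp_nonneg hℓ, rfl⟩ ?_) (huber_le_convEnvelope hℓ ξ)
  rintro _ ⟨g, hg, hgh, rfl⟩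
  exact le_huber_of_convexOn hℓ hg hgh ξ

end Envelope

/-! ### Pointwise estimates for the excess -/

section Excess

/-- Pointwise consequences of a small gap between `min (r ^ 2) (ℓ * r)` and its tangent at
infinity, for a vector of norm `r`, with component `s` along the direction of the tangent. -/
lemma excess_bounds {ℓ r s e : ℝ} (hℓ : 0 < ℓ) (hsr : s ≤ r) (hsr' : -r ≤ s)
    (he : e = min (r ^ 2) (ℓ * r) - ℓ * s + ℓ ^ 2 / 4) :
    0 ≤ e ∧ (ℓ ≤ r → ℓ ^ 2 / 4 ≤ e ∧ ℓ / 2 - s ≤ e / ℓ) ∧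
      (r ≤ 2 * ℓ → (s - ℓ / 2) ^ 2 ≤ 25 * e) ∧
      r ≤ s + e / ℓ + 2 * ℓ ∧ r ^ 2 - s ^ 2 ≤ (2 * r / ℓ + 1) * e := by
  have hr : 0 ≤ r := by linarith
  rcases le_total r ℓ with h | h
  · rw [min_eq_left (by nlinarith)] at he
    -- The two nonnegative terms measure the deviation from the line of `N` and the distance of `s`
    -- from the point of tangency.
    have he' : e = (r ^ 2 - s ^ 2) + (s - ℓ / 2) ^ 2 := by rw [he]; ring
    have h1 : 0 ≤ r ^ 2 - s ^ 2 := by nlinarith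
    have he0 : 0 ≤ e := by rw [he']; positivity
    refine ⟨he0, fun h2 => ?_, fun _ => ?_, ?_, ?_⟩
    · have : r = ℓ := le_antisymm h h2
      subst this
      constructor
      · nlinarith
      · rw [le_div_iff₀ hℓ]
        nlinarith
    · linarith
    · have : 0 ≤ e / ℓ := by positivity
      linarith
    · have h3 : 0 ≤ 2 * r / ℓ * e := by positivity
      nlinarith [sq_nonneg (s - ℓ / 2)]
  · rw [min_eq_right (by nlinarith)] at he
    have he' : e = ℓ * (r - s) + ℓ ^ 2 / 4 := by rw [he]; ring
    have h1 : 0 ≤ ℓ * (r - s) := mul_nonneg hℓ.le (by linarith)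
    have he0 : 0 ≤ e := by rw [he']; positivity
    have h2 : r - s ≤ e / ℓ := by
      rw [le_div_iff₀ hℓ, he']
      nlinarith
    refine ⟨he0, fun _ => ⟨by linarith, by linarith⟩, fun h3 => ?_, by linarith, ?_⟩
    -- Here `|s| ≤ 2 * ℓ` gives `(s - ℓ / 2) ^ 2 ≤ 25 * (ℓ ^ 2 / 4)`, and `e ≥ ℓ ^ 2 / 4`: the
    -- origin of the constant 25.
    · nlinarith
    · have h3 : 2 * r / ℓ * e = 2 * r * (e / ℓ) := by ring
      have h4 : 2 * r * (r - s) ≤ 2 * r * (e / ℓ) :=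
        mul_le_mul_of_nonneg_left h2 (by linarith)
      nlinarith

/-- Young's inequality trades the square root of the excess for a small constant plus a multiple of
the excess, which can be integrated. -/
lemma abs_le_add_div_of_sq_le {x e τ C : ℝ} (hτ : 0 < τ) (h : x ^ 2 ≤ C * e) :
    |x| ≤ τ + C / (4 * τ) * e := by
  have h1 : 0 ≤ (|x| - 2 * τ) ^ 2 := sq_nonneg _
  have h2 : |x| ^ 2 ≤ C * e := by rwa [sq_abs]
  have h3 : C / (4 * τ) * e = C * e / (4 * τ) := by ring
  rw [h3, ← sub_le_iff_le_add', le_div_iff₀ (by positivity)]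
  nlinarith

lemma le_of_sq_le_mul {x a b t : ℝ} (ht : 0 < t) (hx : 0 ≤ x) (hab : x ^ 2 ≤ a * b) (hb : 0 ≤ b)
    (ha : 0 ≤ a) : x ≤ t / 2 * a + b / (2 * t) := by
  refine (sq_le_sq₀ hx (by positivity)).mp ?_
  have : (t / 2 * a + b / (2 * t)) ^ 2 = (t / 2 * a - b / (2 * t)) ^ 2 + a * b := by
    field_simp
    ring
  nlinarith [sq_nonneg (t / 2 * a - b / (2 * t))]

end Excess

/-! ### Test functions on the cube -/

section Cube
variable {n : ℕ}

lemma unitCube_eq_preimage (n : ℕ) :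
    unitCube n = WithLp.ofLp ⁻¹' (univ.pi fun _ : Fin n => Ioo (0 : ℝ) 1) := by
  ext x
  simp [unitCube]

lemma isOpen_unitCube (n : ℕ) : IsOpen (unitCube n) := by
  rw [unitCube_eq_preimage]
  exact (isOpen_set_pi finite_univ fun _ _ => isOpen_Ioo).preimage (PiLp.continuous_ofLp 2 _)

lemma volume_unitCube (n : ℕ) : volume (unitCube n) = 1 := by
  rw [unitCube_eq_preimage, (PiLp.volume_preserving_ofLp (Fin n)).measure_preimage
    (MeasurableSet.univ_pi fun _ => measurableSet_Ioo).nullMeasurableSet, volume_pi_pi]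
  simp

lemma volume_unitCube_ne_top (n : ℕ) : volume (unitCube n) ≠ ⊤ := by
  rw [volume_unitCube]; simp

lemma volume_real_unitCube (n : ℕ) : volume.real (unitCube n) = 1 := by
  simp [measureReal_def, volume_unitCube]

/-- The closed unit cube. -/
def closedUnitCube (n : ℕ) : Set (EuclideanSpace ℝ (Fin n)) :=
  WithLp.ofLp ⁻¹' (univ.pi fun _ : Fin n => Icc (0 : ℝ) 1)

lemma isCompact_closedUnitCube (n : ℕ) : IsCompact (closedUnitCube n) := by
  have h := (isCompact_univ_pi fun _ : Fin n => isCompact_Icc (a := (0 : ℝ)) (b := 1)).image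
    (PiLp.continuous_toLp 2 fun _ : Fin n => ℝ)
  convert h
  ext x
  simp only [closedUnitCube, mem_preimage, mem_image]
  exact ⟨fun hx => ⟨x.ofLp, hx, rfl⟩, by rintro ⟨y, hy, rfl⟩; exact hy⟩

lemma unitCube_subset_closedUnitCube (n : ℕ) : unitCube n ⊆ closedUnitCube n := by
  rw [unitCube_eq_preimage]
  exact preimage_mono (pi_mono fun _ _ => Ioo_subset_Icc_self)

lemma Continuous.integrableOn_unitCube {f : EuclideanSpace ℝ (Fin n) → ℝ} (hf : Continuous f) :
    IntegrableOn f (unitCube n) :=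
  (hf.continuousOn.integrableOn_compact (isCompact_closedUnitCube n)).mono_set
    (unitCube_subset_closedUnitCube n)

/-- Half-open intervals match `unitSquare` and differ from the open ones by a null set; the product
form allows integration over two coordinates first. -/
lemma setLIntegral_unitCube (f : EuclideanSpace ℝ (Fin n) → ENNReal) :
    ∫⁻ x in unitCube n, f x = ∫⁻ y, f (WithLp.toLp 2 y)
      ∂(Measure.pi fun _ : Fin n => (volume : Measure ℝ).restrict (Ico 0 1)) := by
  have h1 := (PiLp.volume_preserving_toLp (Fin n)).setLIntegral_comp_preimage_emb
    (MeasurableEquiv.toLp 2 (Fin n → ℝ)).measurableEmbedding f (unitCube n)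
  have h2 : WithLp.toLp 2 ⁻¹' unitCube n = univ.pi fun _ : Fin n => Ioo (0 : ℝ) 1 := by
    ext x
    simp [unitCube]
  have h3 : (volume : Measure ℝ).restrict (Ico 0 1) = volume.restrict (Ioo 0 1) :=
    Measure.restrict_congr_set Ioo_ae_eq_Ico.symm
  rw [← h1, h2, volume_pi, Measure.restrict_pi_pi, h3]

/-- If a nonnegative function has integral at least `θ` over every unit square parallel to a
coordinate plane, then its integral over the cube is at least `θ`. -/
lemma le_setIntegral_unitCube_of_slices {f : EuclideanSpace ℝ (Fin n) → ℝ} (hf : Continuous f)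
    (hf0 : ∀ x, 0 ≤ f x) {j j' : Fin n} (hj : j ≠ j') {θ : ℝ}
    (h : ∀ y : Fin n → ℝ, θ ≤ ∫ z in unitSquare,
      f (WithLp.toLp 2 (Function.update (Function.update y j z.1) j' z.2))) :
    θ ≤ ∫ x in unitCube n, f x := by
  classical
  set μ : Fin n → Measure ℝ := fun _ => (volume : Measure ℝ).restrict (Ico 0 1) with hμ
  have hprob : ∀ i, IsProbabilityMeasure (μ i) := fun i => ⟨by simp [hμ]⟩
  set g : (Fin n → ℝ) → ENNReal := fun y => ENNReal.ofReal (f (WithLp.toLp 2 y)) with hg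
  have hgc : Continuous fun y : Fin n → ℝ => f (WithLp.toLp 2 y) :=
    hf.comp (PiLp.continuous_toLp 2 _)
  have hgm : Measurable g := hgc.measurable.ennreal_ofReal
  have hslice : ∀ y, ENNReal.ofReal θ ≤ (∫⋯∫⁻_{j, j'}, g ∂μ) y := by
    intro y
    have hc : Continuous fun z : ℝ × ℝ =>
        f (WithLp.toLp 2 (Function.update (Function.update y j z.1) j' z.2)) :=
      hgc.comp (Continuous.update (A := fun _ : Fin n => ℝ)
        (Continuous.update (A := fun _ : Fin n => ℝ) continuous_const j continuous_fst) j'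
        continuous_snd)
    rw [lmarginal_insert g hgm (by simpa using hj)]
    simp only [lmarginal_singleton]
    refine (ENNReal.ofReal_le_ofReal (h y)).trans_eq ?_
    rw [ofReal_integral_eq_lintegral_ofReal hc.integrableOn_unitSquare
      (Filter.Eventually.of_forall fun z => hf0 _), unitSquare, Measure.volume_eq_prod,
      ← Measure.prod_restrict, lintegral_prod _ hc.measurable.ennreal_ofReal.aemeasurable]
  have hlow : ENNReal.ofReal θ ≤ ∫⁻ x in unitCube n, ENNReal.ofReal (f x) := by
    rw [setLIntegral_unitCube]
    have e1 : ∫⁻ y, g y ∂(Measure.pi μ) = (∫⋯∫⁻_Finset.univ, g ∂μ) 0 := by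
      rw [lmarginal_univ]
    have e2 : (Finset.univ : Finset (Fin n)) = {j, j'}ᶜ ∪ {j, j'} := by
      rw [Finset.union_comm, Finset.union_compl]
    change _ ≤ ∫⁻ y, g y ∂(Measure.pi μ)
    rw [e1, e2, lmarginal_union μ g hgm disjoint_compl_left]
    calc ENNReal.ofReal θ = (∫⋯∫⁻_{j, j'}ᶜ, (fun _ => ENNReal.ofReal θ) ∂μ) 0 := by
          simp only [lmarginal, lintegral_const]
          rw [@measure_univ _ _ _ (@Measure.pi.instIsProbabilityMeasure _ _ _ _ _
            fun i => hprob i.1), mul_one]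
      _ ≤ _ := lmarginal_mono (fun y => hslice y) 0
  rw [← ofReal_integral_eq_lintegral_ofReal hf.integrableOn_unitCube
    (Filter.Eventually.of_forall hf0)] at hlow
  exact (ENNReal.ofReal_le_ofReal_iff (integral_nonneg hf0)).mp hlow

end Cube

/-! ### Gradients of test functions and Jensen's inequality -/

section TestFunction
variable {m n : ℕ} {φ : EuclideanSpace ℝ (Fin n) → EuclideanSpace ℝ (Fin m)}

lemma contDiff_apply_comp {k : ℕ∞ω} (hφ : ContDiff ℝ k φ) (i : Fin m) :
    ContDiff ℝ k fun x => φ x i :=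
  (EuclideanSpace.proj (𝕜 := ℝ) i).contDiff.comp hφ

lemma fderiv_apply_comp (hφ : Differentiable ℝ φ) (i : Fin m) (x v : EuclideanSpace ℝ (Fin n)) :
    fderiv ℝ (fun x => φ x i) x v = fderiv ℝ φ x v i := by
  have h := (EuclideanSpace.proj (𝕜 := ℝ) i).hasFDerivAt.comp x (hφ x).hasFDerivAt
  have h2 : (fun x => φ x i) = (EuclideanSpace.proj (𝕜 := ℝ) i) ∘ φ := rfl
  rw [h2, h.fderiv]
  rfl

lemma IsCubeTestFunction.differentiable (hφ : IsCubeTestFunction φ) : Differentiable ℝ φ :=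
  hφ.contDiff.differentiable (by norm_num)

lemma IsCubeTestFunction.continuous_gradMatrix_apply (hφ : IsCubeTestFunction φ) (i : Fin m)
    (j : Fin n) : Continuous fun x => gradMatrix φ x i j := by
  have h : Continuous fun x => fderiv ℝ φ x (EuclideanSpace.single j 1) :=
    (hφ.contDiff.continuous_fderiv (by norm_num)).clm_apply continuous_const
  exact (EuclideanSpace.proj (𝕜 := ℝ) i).continuous.comp h

lemma IsCubeTestFunction.continuous_add_gradMatrix_apply (hφ : IsCubeTestFunction φ)
    (ξ : Matrix (Fin m) (Fin n) ℝ) (i : Fin m) (j : Fin n) :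
    Continuous fun x => (ξ + gradMatrix φ x) i j :=
  continuous_const.add (hφ.continuous_gradMatrix_apply i j)

lemma IsCubeTestFunction.setIntegral_gradMatrix_apply (hφ : IsCubeTestFunction φ) (i : Fin m)
    (j : Fin n) : ∫ x in unitCube n, gradMatrix φ x i j = 0 := by
  have hcont := hφ.continuous_gradMatrix_apply i j
  have hsupp : ∀ x ∉ tsupport φ, gradMatrix φ x i j = 0 := by
    intro x hx
    have h1 : fderiv ℝ φ x = 0 :=
      image_eq_zero_of_notMem_tsupport fun h => hx (tsupport_fderiv_subset ℝ h)
    simp [gradMatrix, h1]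
  rw [setIntegral_eq_integral_of_forall_compl_eq_zero
    fun x hx => hsupp x fun h => hx (hφ.tsupport_subset h)]
  have hint : Integrable fun x => gradMatrix φ x i j :=
    hcont.integrable_of_hasCompactSupport
      (HasCompactSupport.intro hφ.hasCompactSupport.isCompact hsupp)
  have hφi : HasCompactSupport fun x => φ x i := by
    refine HasCompactSupport.intro hφ.hasCompactSupport.isCompact fun x hx => ?_
    rw [image_eq_zero_of_notMem_tsupport hx]
    rfl
  have hφc : Continuous fun x => φ x i := (contDiff_apply_comp hφ.contDiff i).continuous
  have hφd : Differentiable ℝ fun x => φ x i :=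
    (contDiff_apply_comp hφ.contDiff i).differentiable (by norm_num)
  have h := integral_bilinear_hasLineDerivAt_right_eq_neg_left_of_integrable
    (μ := (volume : Measure (EuclideanSpace ℝ (Fin n)))) (f := fun _ => (1 : ℝ))
    (f' := fun _ => 0) (g := fun x => φ x i) (g' := fun x => gradMatrix φ x i j)
    (v := EuclideanSpace.single j 1) (B := ContinuousLinearMap.mul ℝ ℝ)
    (by simp) (by simpa using hint)
    (by simpa using hφc.integrable_of_hasCompactSupport hφi)
    (fun x _ => (hasFDerivAt_const (1 : ℝ) x).hasLineDerivAt _)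
    (fun x _ => by
      have := (hφd x).hasFDerivAt.hasLineDerivAt (EuclideanSpace.single j 1)
      rwa [fderiv_apply_comp hφ.differentiable] at this)
  simpa using h

lemma IsCubeTestFunction.setIntegral_frobInner (hφ : IsCubeTestFunction φ)
    (L : Matrix (Fin m) (Fin n) ℝ) : ∫ x in unitCube n, frobInner L (gradMatrix φ x) = 0 := by
  have hint : ∀ i j, Integrable (fun x => L i j * gradMatrix φ x i j)
      (volume.restrict (unitCube n)) := fun i j =>
    (hφ.continuous_gradMatrix_apply i j).integrableOn_unitCube.const_mul _
  simp only [frobInner]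
  rw [integral_finsetSum _ fun i _ => integrable_finsetSum _ fun j _ => hint i j]
  refine Finset.sum_eq_zero fun i _ => ?_
  rw [integral_finsetSum _ fun j _ => hint i j]
  refine Finset.sum_eq_zero fun j _ => ?_
  rw [integral_const_mul, hφ.setIntegral_gradMatrix_apply, mul_zero]

lemma isCubeTestFunction_zero :
    IsCubeTestFunction (0 : EuclideanSpace ℝ (Fin n) → EuclideanSpace ℝ (Fin m)) :=
  ⟨contDiff_const, HasCompactSupport.zero, by simp [tsupport]⟩

/-- Jensen's inequality for the affine minorants of `h`. -/
lemma IsCubeTestFunction.huber_le_setIntegral (hφ : IsCubeTestFunction φ) {ℓ : ℝ} (hℓ : 0 < ℓ)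
    (ξ : Matrix (Fin m) (Fin n) ℝ) :
    huber ℓ ‖ξ‖ ≤ ∫ x in unitCube n, hSimp m n ℓ (ξ + gradMatrix φ x) := by
  have hi : IntegrableOn (fun x => frobInner (huberSlope ℓ ξ) (gradMatrix φ x)) (unitCube n) :=
    (continuous_frobInner _ hφ.continuous_gradMatrix_apply).integrableOn_unitCube
  have hc : IntegrableOn (fun _ => huber ℓ ‖ξ‖) (unitCube n) :=
    integrableOn_const (volume_unitCube_ne_top n)
  calc huber ℓ ‖ξ‖
      = ∫ x in unitCube n, (huber ℓ ‖ξ‖ + frobInner (huberSlope ℓ ξ) (gradMatrix φ x)) := by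
        rw [integral_add hc hi, hφ.setIntegral_frobInner, setIntegral_const, volume_real_unitCube]
        simp
    _ ≤ _ := by
        refine setIntegral_mono_on (hc.add hi)
          (continuous_hSimp ℓ (hφ.continuous_add_gradMatrix_apply ξ)).integrableOn_unitCube
          (isOpen_unitCube n).measurableSet fun x _ => ?_
        have := huber_add_frobInner_le_hSimp hℓ ξ (ξ + gradMatrix φ x)
        rwa [add_sub_cancel_left] at this

lemma gradMatrix_zero (x : EuclideanSpace ℝ (Fin n)) :
    gradMatrix (0 : EuclideanSpace ℝ (Fin n) → EuclideanSpace ℝ (Fin m)) x = 0 := by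
  ext i j
  simp [gradMatrix]

section qc
variable {ℓ : ℝ} (ξ : Matrix (Fin m) (Fin n) ℝ)

lemma bddBelow_qcEnvelope (hℓ : 0 < ℓ) :
    BddBelow {r : ℝ | ∃ φ : EuclideanSpace ℝ (Fin n) → EuclideanSpace ℝ (Fin m),
      IsCubeTestFunction φ ∧ r = ∫ x in unitCube n, hSimp m n ℓ (ξ + gradMatrix φ x)} :=
  ⟨huber ℓ ‖ξ‖, by rintro _ ⟨φ, hφ, rfl⟩; exact hφ.huber_le_setIntegral hℓ ξ⟩

lemma qcEnvelope_le_setIntegral (hℓ : 0 < ℓ) (hφ : IsCubeTestFunction φ) :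
    qcEnvelope (hSimp m n ℓ) ξ ≤ ∫ x in unitCube n, hSimp m n ℓ (ξ + gradMatrix φ x) :=
  csInf_le (bddBelow_qcEnvelope ξ hℓ) ⟨φ, hφ, rfl⟩

lemma le_qcEnvelope_of_forall {c : ℝ}
    (h : ∀ φ : EuclideanSpace ℝ (Fin n) → EuclideanSpace ℝ (Fin m), IsCubeTestFunction φ →
      c ≤ ∫ x in unitCube n, hSimp m n ℓ (ξ + gradMatrix φ x)) :
    c ≤ qcEnvelope (hSimp m n ℓ) ξ :=
  le_csInf ⟨_, 0, isCubeTestFunction_zero, rfl⟩ (by rintro _ ⟨φ, hφ, rfl⟩; exact h φ hφ)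

lemma qcEnvelope_le_hSimp (hℓ : 0 < ℓ) : qcEnvelope (hSimp m n ℓ) ξ ≤ hSimp m n ℓ ξ := by
  refine (qcEnvelope_le_setIntegral ξ hℓ isCubeTestFunction_zero).trans_eq ?_
  simp only [gradMatrix_zero, add_zero, setIntegral_const, volume_real_unitCube, one_smul]

lemma huber_le_qcEnvelope (hℓ : 0 < ℓ) : huber ℓ ‖ξ‖ ≤ qcEnvelope (hSimp m n ℓ) ξ :=
  le_qcEnvelope_of_forall ξ fun _ hφ => hφ.huber_le_setIntegral hℓ ξ

end qc
end TestFunction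

/-! ### A gap between the envelopes at matrices with a nonzero minor -/

section Slice
variable {m n : ℕ}

/-- The point with coordinates `y`, except that the coordinates `j` and `j'` are given by `z`. -/
def slicePoint (y : Fin n → ℝ) (j j' : Fin n) (z : ℝ × ℝ) : EuclideanSpace ℝ (Fin n) :=
  WithLp.toLp 2 (Function.update (Function.update y j z.1) j' z.2)

lemma slicePoint_eq (y : Fin n → ℝ) {j j' : Fin n} (hj : j ≠ j') (z : ℝ × ℝ) :
    slicePoint y j j' z = slicePoint y j j' 0 +
      (z.1 • EuclideanSpace.single j (1 : ℝ) + z.2 • EuclideanSpace.single j' (1 : ℝ)) := by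
  ext k
  by_cases h' : k = j'
  · subst h'
    simp [slicePoint, hj.symm]
  · by_cases h : k = j
    · subst h
      simp [slicePoint, hj]
    · simp [slicePoint, h, h']

/-- The linear part of the parametrization of a slice. -/
noncomputable def sliceLinear (j j' : Fin n) : ℝ × ℝ →L[ℝ] EuclideanSpace ℝ (Fin n) :=
  (ContinuousLinearMap.fst ℝ ℝ ℝ).smulRight (EuclideanSpace.single j (1 : ℝ)) +
    (ContinuousLinearMap.snd ℝ ℝ ℝ).smulRight (EuclideanSpace.single j' (1 : ℝ))

lemma slicePoint_eq_add_sliceLinear (y : Fin n → ℝ) {j j' : Fin n} (hj : j ≠ j') :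
    slicePoint y j j' = fun z => slicePoint y j j' 0 + sliceLinear j j' z := by
  funext z
  rw [slicePoint_eq y hj z]
  rfl

lemma contDiff_slicePoint (y : Fin n → ℝ) {j j' : Fin n} (hj : j ≠ j') :
    ContDiff ℝ ∞ (slicePoint y j j') := by
  rw [slicePoint_eq_add_sliceLinear y hj]
  exact contDiff_const.add (sliceLinear j j').contDiff

lemma fderiv_comp_slicePoint (y : Fin n → ℝ) {j j' : Fin n} (hj : j ≠ j')
    {U : EuclideanSpace ℝ (Fin n) → ℝ} (hU : Differentiable ℝ U) (z w : ℝ × ℝ) :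
    fderiv ℝ (fun z => U (slicePoint y j j' z)) z w =
      fderiv ℝ U (slicePoint y j j' z) (w.1 • EuclideanSpace.single j (1 : ℝ) +
        w.2 • EuclideanSpace.single j' (1 : ℝ)) := by
  have h1 : HasFDerivAt (slicePoint y j j') (sliceLinear j j') z := by
    rw [slicePoint_eq_add_sliceLinear y hj]
    exact (sliceLinear j j').hasFDerivAt.const_add _
  have h2 := (hU (slicePoint y j j' z)).hasFDerivAt.comp z h1
  change fderiv ℝ (U ∘ slicePoint y j j') z w = _
  rw [h2.fderiv]
  rfl

lemma tsupport_comp_slicePoint_subset (y : Fin n → ℝ) {j j' : Fin n} (hj : j ≠ j')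
    {U : EuclideanSpace ℝ (Fin n) → ℝ} (hU : tsupport U ⊆ unitCube n) :
    tsupport (fun z => U (slicePoint y j j' z)) ⊆ unitSquare := by
  refine (tsupport_comp_subset_preimage U (contDiff_slicePoint y hj).continuous).trans
    fun z hz => ?_
  have h := hU hz
  have h1 := h j
  have h2 := h j'
  simp only [slicePoint, Function.update_self, Function.update_of_ne hj] at h1 h2
  exact ⟨Ioo_subset_Ico_self h1, Ioo_subset_Ico_self h2⟩

variable {φ : EuclideanSpace ℝ (Fin n) → EuclideanSpace ℝ (Fin m)}

lemma IsCubeTestFunction.tsupport_combination_subset (hφ : IsCubeTestFunction φ) (α β : ℝ)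
    (i i' : Fin m) : tsupport (fun x => α * φ x i + β * φ x i') ⊆ unitCube n := by
  refine Subset.trans (closure_minimal (fun x hx => ?_) (isClosed_tsupport φ)) hφ.tsupport_subset
  by_contra h
  refine hx ?_
  beta_reduce
  rw [image_eq_zero_of_notMem_tsupport h]
  simp

lemma IsCubeTestFunction.contDiff_combination (hφ : IsCubeTestFunction φ) (α β : ℝ)
    (i i' : Fin m) : ContDiff ℝ ∞ fun x => α * φ x i + β * φ x i' :=
  (contDiff_const.mul (contDiff_apply_comp hφ.contDiff i)).add
    (contDiff_const.mul (contDiff_apply_comp hφ.contDiff i'))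

lemma IsCubeTestFunction.fderiv_combination (hφ : IsCubeTestFunction φ) (α β : ℝ)
    (i i' : Fin m) (x : EuclideanSpace ℝ (Fin n)) (j : Fin n) :
    fderiv ℝ (fun x => α * φ x i + β * φ x i') x (EuclideanSpace.single j 1) =
      α * gradMatrix φ x i j + β * gradMatrix φ x i' j := by
  have hd : ∀ i, DifferentiableAt ℝ (fun x => φ x i) x := fun i =>
    (contDiff_apply_comp hφ.contDiff i).differentiable (by norm_num) x
  have h := (((hd i).hasFDerivAt.const_mul α).add ((hd i').hasFDerivAt.const_mul β)).fderiv
  have h2 : (fun x => α * φ x i + β * φ x i') =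
    (fun x => α * φ x i) + fun x => β * φ x i' := rfl
  rw [h2, h]
  simp [fderiv_apply_comp hφ.differentiable, gradMatrix]

end Slice

/-- Applies a row of the inverse of a two-by-two minor of `N` to the remainder `η - s N`. -/
lemma abs_det_combination_le {b d ζ₁ ζ₂ z D : ℝ} (hD0 : D ≠ 0)
    (hb : |b| ≤ 1) (hd : |d| ≤ 1) (h1 : |ζ₁| ≤ z) (h2 : |ζ₂| ≤ z) :
    |d / D * ζ₁ + -b / D * ζ₂| ≤ 2 / |D| * z := by
  have hD' : 0 < |D| := abs_pos.mpr hD0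
  have hz : 0 ≤ z := (abs_nonneg _).trans h1
  have h3 : d / D * ζ₁ + -b / D * ζ₂ = (d * ζ₁ - b * ζ₂) / D := by ring
  rw [h3, abs_div, div_le_iff₀ hD']
  have h4 : 2 / |D| * z * |D| = 2 * z := by field_simp
  rw [h4]
  have h5 := abs_sub (d * ζ₁) (b * ζ₂)
  rw [abs_mul, abs_mul] at h5
  have h6 : |d| * |ζ₁| ≤ 1 * z := mul_le_mul hd h1 (abs_nonneg _) zero_le_one
  have h7 : |b| * |ζ₂| ≤ 1 * z := mul_le_mul hb h2 (abs_nonneg _) zero_le_one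
  linarith

section Gap
variable {m n : ℕ}

lemma frobenius_norm_sub_smul_sq {N : Matrix (Fin m) (Fin n) ℝ} (hN : ‖N‖ = 1)
    (η : Matrix (Fin m) (Fin n) ℝ) :
    ‖η - frobInner N η • N‖ ^ 2 = ‖η‖ ^ 2 - frobInner N η ^ 2 := by
  have h1 : frobInner (η - frobInner N η • N) η = ‖η‖ ^ 2 - frobInner N η ^ 2 := by
    rw [frobInner_comm, frobInner_sub, frobInner_smul, frobInner_self, frobInner_comm η N, sq,
      sq]
  have h2 : frobInner (η - frobInner N η • N) N = 0 := by
    rw [frobInner_comm, frobInner_sub, frobInner_smul, frobInner_self, hN]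
    ring
  rw [← frobInner_self, frobInner_sub, frobInner_smul, h1, h2, mul_zero, sub_zero]

/-- The convexity gap of `h` on gradients, at a large matrix with a nonzero two-by-two minor. -/
lemma exists_huber_add_le_setIntegral {ℓ : ℝ} (hℓ : 0 < ℓ) (ξ : Matrix (Fin m) (Fin n) ℝ)
    (hξ : ℓ / 2 < ‖ξ‖) {i i' : Fin m} {j j' : Fin n}
    (hminor : ξ i j * ξ i' j' - ξ i j' * ξ i' j ≠ 0) :
    ∃ θ > 0, ∀ φ : EuclideanSpace ℝ (Fin n) → EuclideanSpace ℝ (Fin m), IsCubeTestFunction φ →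
      huber ℓ ‖ξ‖ + θ ≤ ∫ x in unitCube n, hSimp m n ℓ (ξ + gradMatrix φ x) := by
  have hξ0 : 0 < ‖ξ‖ := by linarith
  have hj : j ≠ j' := by
    rintro rfl
    exact hminor (by ring)
  set N := ‖ξ‖⁻¹ • ξ with hNdef
  have hN : ‖N‖ = 1 := by
    rw [hNdef, frobenius_norm_smul, abs_of_pos (by positivity), inv_mul_cancel₀ hξ0.ne']
  have hξN : ξ = ‖ξ‖ • N := by
    rw [hNdef, smul_smul, mul_inv_cancel₀ hξ0.ne', one_smul]
  set D := N i j * N i' j' - N i j' * N i' j with hD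
  have hD0 : D ≠ 0 := by
    have : D = ‖ξ‖⁻¹ ^ 2 * (ξ i j * ξ i' j' - ξ i j' * ξ i' j) := by
      simp only [hD, hNdef, Matrix.smul_apply, smul_eq_mul]
      ring
    rw [this]
    exact mul_ne_zero (by positivity) hminor
  have hD' : 0 < |D| := abs_pos.mpr hD0
  have hNle : ∀ k l, |N k l| ≤ 1 := fun k l => (abs_apply_le_frobenius_norm N k l).trans_eq hN
  set κ := ‖ξ‖ - ℓ / 2 with hκ
  have hκ0 : 0 < κ := by linarith
  set M := 2 / |D| with hM
  have hM0 : 0 < M := by positivity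
  set c := 3 * ℓ with hc
  set σ := min (1 / 2) (κ / 8 / (18 * (κ + c))) with hσ
  have hκc : 0 < κ + c := by positivity
  have hσ0 : 0 < σ := by positivity
  have hσ1 : 18 * σ * (κ + c) ≤ κ / 8 := by
    have h1 : σ ≤ κ / 8 / (18 * (κ + c)) := min_le_right _ _
    rw [le_div_iff₀ (by positivity)] at h1
    linarith
  -- The weight in the arithmetic-geometric inequality for `|η - s N|`, chosen so that `M * t / ℓ =
  -- σ` is the coefficient of `s` in the bound for `Z`; the shift `c = 3 * ℓ` collects the constants
  -- there.
  set t := σ * ℓ / M with ht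
  have ht0 : 0 < t := by positivity
  set C₁ := 25 / (4 * (κ / 40)) + 1 / ℓ with hC₁
  set C₂ := M * (t / ℓ ^ 2 + 1 / (2 * t)) with hC₂
  have hC₁0 : 0 ≤ C₁ := by positivity
  obtain ⟨θ, hθ, hmain⟩ := exists_le_setIntegral_of_gap (κ := κ) (m := ℓ ^ 2 / 4) (ρ := ℓ) (c := c)
    hκ0 (by positivity) hℓ hσ0.le (min_le_left _ _) hσ1 hC₁0 (by positivity : 0 ≤ C₂)
  refine ⟨θ, hθ, fun φ hφ => ?_⟩
  set η := fun x => ξ + gradMatrix φ x with hη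
  have hηc : ∀ k l, Continuous fun x => η x k l := hφ.continuous_add_gradMatrix_apply ξ
  set s := fun x => frobInner N (η x) with hs
  have hsc : Continuous s := continuous_frobInner N hηc
  set e := fun x => hSimp m n ℓ (η x) - ℓ * s x + ℓ ^ 2 / 4 with he
  have hhc : Continuous fun x => hSimp m n ℓ (η x) := continuous_hSimp ℓ hηc
  have hec : Continuous e := (hhc.sub (continuous_const.mul hsc)).add continuous_const
  have hrc : Continuous fun x => ‖η x‖ := continuous_frobenius_norm hηc
  have hζc : Continuous fun x => ‖η x - s x • N‖ :=
    continuous_frobenius_norm fun k l => (hηc k l).sub (hsc.mul continuous_const)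
  have hb := fun x => excess_bounds (ℓ := ℓ) (r := ‖η x‖) (s := s x) (e := e x) hℓ
    (by simpa [hN] using frobInner_le N (η x)) (by simpa [hN] using neg_le_frobInner N (η x)) rfl
  have he0 : ∀ x, 0 ≤ e x := fun x => (hb x).1
  have hgrad : ∀ x k l, gradMatrix φ x k l = (s x - ‖ξ‖) * N k l + (η x - s x • N) k l := by
    intro x k l
    have : ξ k l = ‖ξ‖ * N k l := by
      conv_lhs => rw [hξN]
      rfl
    simp only [hη, Matrix.sub_apply, Matrix.add_apply, Matrix.smul_apply, smul_eq_mul, this]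
    ring
  have hζ : ∀ x k l, |(η x - s x • N) k l| ≤ ‖η x - s x • N‖ := fun x k l =>
    abs_apply_le_frobenius_norm _ k l
  have hslices : θ ≤ ∫ x in unitCube n, e x := by
    refine le_setIntegral_unitCube_of_slices hec he0 hj fun y => ?_
    have hPc : Continuous (slicePoint y j j') := (contDiff_slicePoint y hj).continuous
    have hcomb : ∀ α β, Differentiable ℝ fun x => α * φ x i + β * φ x i' := fun α β =>
      (hφ.contDiff_combination α β i i').differentiable (by norm_num)
    have hder1 : ∀ α β z, fderiv ℝ (fun z => α * φ (slicePoint y j j' z) i +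
        β * φ (slicePoint y j j' z) i') z (1, 0) =
        α * gradMatrix φ (slicePoint y j j' z) i j +
        β * gradMatrix φ (slicePoint y j j' z) i' j := by
      intro α β z
      rw [fderiv_comp_slicePoint y hj (hcomb α β)]
      simp only [one_smul, zero_smul, add_zero]
      exact hφ.fderiv_combination α β i i' _ j
    have hder2 : ∀ α β z, fderiv ℝ (fun z => α * φ (slicePoint y j j' z) i +
        β * φ (slicePoint y j j' z) i') z (0, 1) =
        α * gradMatrix φ (slicePoint y j j' z) i j' +
        β * gradMatrix φ (slicePoint y j j' z) i' j' := by
      intro α β z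
      rw [fderiv_comp_slicePoint y hj (hcomb α β)]
      simp only [one_smul, zero_smul, zero_add]
      exact hφ.fderiv_combination α β i i' _ j'
    have hcd : ∀ α β, ContDiff ℝ 1 fun z => α * φ (slicePoint y j j' z) i +
        β * φ (slicePoint y j j' z) i' := fun α β =>
      ((hφ.contDiff_combination α β i i').comp (contDiff_slicePoint y hj)).of_le (by norm_num)
    -- The coefficients are the rows of the inverse of the minor of `N` (Cramer's rule), so the part
    -- `(s - |ξ|) N` of `∇φ` becomes `(p - κ)` times the identity.
    refine hmain
      (fun z => N i' j' / D * φ (slicePoint y j j' z) i + -N i j' / D * φ (slicePoint y j j' z) i')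
      (fun z => -N i' j / D * φ (slicePoint y j j' z) i + N i j / D * φ (slicePoint y j j' z) i')
      (fun z => s (slicePoint y j j' z) - ℓ / 2)
      (fun z => M * ‖η (slicePoint y j j' z) - s (slicePoint y j j' z) • N‖)
      (fun z => e (slicePoint y j j' z)) (fun z => ‖η (slicePoint y j j' z)‖)
      (hcd _ _) (hcd _ _)
      (tsupport_comp_slicePoint_subset y hj (hφ.tsupport_combination_subset _ _ _ _))
      (tsupport_comp_slicePoint_subset y hj (hφ.tsupport_combination_subset _ _ _ _))
      ((hsc.comp hPc).sub continuous_const) (continuous_const.mul (hζc.comp hPc))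
      (hec.comp hPc) (hrc.comp hPc) ?_ ?_ ?_ ?_ (fun z => he0 _) (fun z h => ((hb _).2.1 h).1)
      ?_ ?_ ?_
    · intro z
      rw [hder1, hgrad, hgrad]
      have := abs_det_combination_le hD0 (hNle i j') (hNle i' j') (hζ (slicePoint y j j' z) i j)
        (hζ (slicePoint y j j' z) i' j)
      refine le_trans (le_of_eq ?_) this
      congr 1
      rw [hκ]
      field_simp
      rw [hD]
      ring
    · intro z
      rw [hder2, hgrad, hgrad]
      have := abs_det_combination_le hD0 (hNle i j') (hNle i' j')
        (hζ (slicePoint y j j' z) i j') (hζ (slicePoint y j j' z) i' j')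
      refine le_trans (le_of_eq ?_) this
      congr 1
      field_simp
      ring
    · intro z
      rw [hder2, hgrad, hgrad]
      have := abs_det_combination_le hD0 (hNle i' j) (hNle i j)
        (hζ (slicePoint y j j' z) i' j') (hζ (slicePoint y j j' z) i j')
      refine le_trans (le_of_eq ?_) this
      congr 1
      rw [hκ]
      field_simp
      rw [hD]
      ring
    · intro z
      rw [hder1, hgrad, hgrad]
      have := abs_det_combination_le hD0 (hNle i' j) (hNle i j)
        (hζ (slicePoint y j j' z) i' j) (hζ (slicePoint y j j' z) i j)
      refine le_trans (le_of_eq ?_) this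
      congr 1
      field_simp
      ring
    · intro z
      set x := slicePoint y j j' z
      have h0 := he0 x
      have hsplit : C₁ * e x = 25 / (4 * (κ / 40)) * e x + e x / ℓ := by rw [hC₁]; ring
      have p1 : 0 ≤ 25 / (4 * (κ / 40)) * e x := by positivity
      have p2 : 0 ≤ e x / ℓ := by positivity
      -- For moderate `η` the quadratic bound controls `|p|`; for large `η` only a lower bound on
      -- `p` is available, and it suffices.
      rcases le_total ‖η x‖ (2 * ℓ) with h | h
      · have h1 := abs_le_add_div_of_sq_le (by positivity : 0 < κ / 40) ((hb x).2.2.1 h)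
        have h2 := (abs_le.mp h1).1
        rw [hsplit]
        linarith
      · have h1 := ((hb x).2.1 (by linarith)).2
        rw [hsplit]
        linarith
    · intro z h
      set x := slicePoint y j j' z
      have h0 := he0 x
      have hsplit : C₁ * e x = 25 / (4 * (κ / 40)) * e x + e x / ℓ := by rw [hC₁]; ring
      have p2 : 0 ≤ e x / ℓ := by positivity
      have h1 := abs_le_add_div_of_sq_le (by positivity : 0 < κ / 40) ((hb x).2.2.1 h)
      have h2 := (abs_le.mp h1).2
      rw [hsplit]
      linarith
    · intro z
      set x := slicePoint y j j' z
      have h0 := he0 x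
      have hr := norm_nonneg (η x)
      have h1 := le_of_sq_le_mul (x := ‖η x - s x • N‖) (a := 2 * ‖η x‖ / ℓ + 1) (b := e x) ht0
        (norm_nonneg _) ((frobenius_norm_sub_smul_sq hN (η x)).trans_le (hb x).2.2.2.2) h0
        (by positivity)
      have h2 := (hb x).2.2.2.1
      have h3 : 2 * ‖η x‖ / ℓ + 1 ≤ 2 * (s x + e x / ℓ + 2 * ℓ) / ℓ + 1 := by gcongr
      have h4 : t / 2 * (2 * ‖η x‖ / ℓ + 1) ≤ t / 2 * (2 * (s x + e x / ℓ + 2 * ℓ) / ℓ + 1) :=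
        mul_le_mul_of_nonneg_left h3 (by positivity)
      have h5 : M * (t / 2 * (2 * (s x + e x / ℓ + 2 * ℓ) / ℓ + 1) + e x / (2 * t)) =
          σ * (s x - ℓ / 2 + c) + C₂ * e x := by
        have h6 : M * t = σ * ℓ := by rw [ht]; field_simp
        have h7 : M * (t / 2 * (2 * (s x + e x / ℓ + 2 * ℓ) / ℓ + 1) + e x / (2 * t)) =
            M * t * ((s x + 2 * ℓ) / ℓ + 1 / 2) + M * (t / ℓ ^ 2 + 1 / (2 * t)) * e x := by
          field_simp
          ring
        rw [h7, h6, hC₂, hc]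
        congr 1
        field_simp
        ring
      rw [← h5]
      exact mul_le_mul_of_nonneg_left (by linarith) hM0.le
  -- The tangent terms integrate to the Huber value because `∇φ` has mean zero.
  have hse : ∫ x in unitCube n, e x =
      (∫ x in unitCube n, hSimp m n ℓ (ξ + gradMatrix φ x)) - huber ℓ ‖ξ‖ := by
    have ih := hhc.integrableOn_unitCube
    have hic : ∀ a : ℝ, IntegrableOn (fun _ => a) (unitCube n) := fun a =>
      integrableOn_const (volume_unitCube_ne_top n)
    have hig : IntegrableOn (fun x => frobInner N (gradMatrix φ x)) (unitCube n) :=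
      (continuous_frobInner N hφ.continuous_gradMatrix_apply).integrableOn_unitCube
    have hNξ : frobInner N ξ = ‖ξ‖ := by
      conv_lhs => rw [hξN]
      rw [frobInner_smul, frobInner_self, hN]
      ring
    have e1 : e = fun x => hSimp m n ℓ (η x) - (ℓ * frobInner N (gradMatrix φ x) +
        huber ℓ ‖ξ‖) := by
      funext x
      simp only [he, hs, hη]
      rw [frobInner_add, hNξ, huber, if_neg (by linarith)]
      ring
    have ih2 : IntegrableOn (fun x => ℓ * frobInner N (gradMatrix φ x) + huber ℓ ‖ξ‖)
        (unitCube n) := (hig.const_mul ℓ).add (hic _)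
    rw [e1, integral_sub ih ih2, integral_add (hig.const_mul ℓ) (hic _), integral_const_mul,
      hφ.setIntegral_frobInner, setIntegral_const, volume_real_unitCube]
    simp [hη]
  linarith

/-! ### Rank and two-by-two minors -/

/-- A matrix all of whose two-by-two minors vanish is an outer product. -/
lemma exists_eq_vecMulVec_of_minors (ξ : Matrix (Fin m) (Fin n) ℝ)
    (h : ∀ i i' j j', ξ i j * ξ i' j' - ξ i j' * ξ i' j = 0) :
    ∃ (a : Fin m → ℝ) (b : Fin n → ℝ), ξ = Matrix.vecMulVec a b := by
  by_cases h0 : ξ = 0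
  · exact ⟨0, 0, by simp [h0]⟩
  · obtain ⟨i, j, hij⟩ : ∃ i j, ξ i j ≠ 0 := by
      by_contra hcon
      push Not at hcon
      exact h0 (Matrix.ext fun i j => hcon i j)
    refine ⟨fun k => ξ k j / ξ i j, fun l => ξ i l, ?_⟩
    ext k l
    rw [Matrix.vecMulVec_apply]
    field_simp
    linarith [h i k j l]

lemma exists_minor_ne_zero_of_two_le_rank {ξ : Matrix (Fin m) (Fin n) ℝ} (h : 2 ≤ ξ.rank) :
    ∃ i i' j j', ξ i j * ξ i' j' - ξ i j' * ξ i' j ≠ 0 := by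
  by_contra hcon
  push Not at hcon
  obtain ⟨a, b, rfl⟩ := exists_eq_vecMulVec_of_minors ξ hcon
  have := Matrix.rank_vecMulVec_le a b
  omega

lemma two_le_rank_of_minor_ne_zero {ξ : Matrix (Fin m) (Fin n) ℝ} {i i' : Fin m} {j j' : Fin n}
    (h : ξ i j * ξ i' j' - ξ i j' * ξ i' j ≠ 0) : 2 ≤ ξ.rank := by
  have h1 := Matrix.rank_submatrix_le ξ ![i, i'] ![j, j']
  have h2 : (ξ.submatrix ![i, i'] ![j, j']).rank = Fintype.card (Fin 2) := by
    refine Matrix.rank_of_isUnit _ ?_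
    rw [Matrix.isUnit_iff_isUnit_det, Matrix.det_fin_two, isUnit_iff_ne_zero]
    simpa using h
  rw [h2] at h1
  simpa using h1

/-- A matrix of rank at most one is an outer product. -/
lemma exists_eq_vecMulVec_of_rank_le_one {ξ : Matrix (Fin m) (Fin n) ℝ} (h : ξ.rank ≤ 1) :
    ∃ (a : Fin m → ℝ) (b : Fin n → ℝ), ξ = Matrix.vecMulVec a b := by
  refine exists_eq_vecMulVec_of_minors ξ fun i i' j j' => ?_
  by_contra hcon
  have := two_le_rank_of_minor_ne_zero hcon
  omega

lemma convEnvelope_lt_qcEnvelope {ℓ : ℝ} (hℓ : 0 < ℓ) {ξ : Matrix (Fin m) (Fin n) ℝ}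
    (hr : 2 ≤ ξ.rank) (hξ : ℓ / 2 < ‖ξ‖) :
    convEnvelope (hSimp m n ℓ) ξ < qcEnvelope (hSimp m n ℓ) ξ := by
  obtain ⟨i, i', j, j', h⟩ := exists_minor_ne_zero_of_two_le_rank hr
  obtain ⟨θ, hθ, hmain⟩ := exists_huber_add_le_setIntegral hℓ ξ hξ h
  rw [convEnvelope_hSimp hℓ]
  have := le_qcEnvelope_of_forall ξ hmain
  linarith

end Gap

/-! ### Laminates in rank-one directions -/

section Profile

/-- The scalar profile of `h`. -/
def radialDensity (ℓ t : ℝ) : ℝ := min (t ^ 2) (ℓ * t)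

lemma continuous_radialDensity (ℓ : ℝ) : Continuous (radialDensity ℓ) :=
  (continuous_id.pow 2).min (continuous_const.mul continuous_id)

lemma radialDensity_nonneg {ℓ t : ℝ} (hℓ : 0 < ℓ) (ht : 0 ≤ t) : 0 ≤ radialDensity ℓ t :=
  le_min (by positivity) (by positivity)

lemma radialDensity_add_le {ℓ r δ : ℝ} (hr : 0 ≤ r) (hδ : 0 ≤ δ) (hℓ : 0 < ℓ) :
    radialDensity ℓ (r + δ) ≤ radialDensity ℓ r + 2 * ℓ * δ := by
  have h1 : 0 ≤ ℓ * δ := by positivity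
  rcases le_total r ℓ with h | h
  · have e : radialDensity ℓ r = r ^ 2 := min_eq_left (by nlinarith)
    rw [e]
    rcases le_total (r + δ) ℓ with h2 | h2
    · refine (min_le_left _ _).trans ?_
      nlinarith
    · refine (min_le_right _ _).trans ?_
      nlinarith [sq_nonneg (ℓ - r)]
  · have e : radialDensity ℓ r = ℓ * r := min_eq_right (by nlinarith)
    rw [e]
    refine (min_le_right _ _).trans ?_
    nlinarith

lemma radialDensity_mono {ℓ r r' : ℝ} (hr : 0 ≤ r) (h : r ≤ r') (hℓ : 0 < ℓ) :
    radialDensity ℓ r ≤ radialDensity ℓ r' :=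
  min_le_min (by gcongr) (by gcongr)

/-- A periodic bump concentrated near the integers. -/
noncomputable def periodicBump (δ t : ℝ) : ℝ := expNegInvGlue (δ - Real.sin (Real.pi * t) ^ 2)

lemma contDiff_periodicBump (δ : ℝ) : ContDiff ℝ ∞ (periodicBump δ) :=
  expNegInvGlue.contDiff.comp
    (contDiff_const.sub ((Real.contDiff_sin.comp (contDiff_const.mul contDiff_id)).pow 2))

lemma periodic_periodicBump (δ : ℝ) : Function.Periodic (periodicBump δ) 1 := by
  intro t
  simp only [periodicBump, mul_add, mul_one, Real.sin_add_pi, neg_sq]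

/-- The period-cell part of the support of the periodic bump. -/
def bumpSet (δ : ℝ) : Set ℝ := {t | t ∈ Ioc (0 : ℝ) 1 ∧ Real.sin (Real.pi * t) ^ 2 < δ}

lemma measurableSet_bumpSet (δ : ℝ) : MeasurableSet (bumpSet δ) :=
  measurableSet_Ioc.inter (measurableSet_lt
    ((Real.measurable_sin.comp (measurable_const.mul measurable_id)).pow_const 2) measurable_const)

lemma exists_volume_bumpSet_le {ε : ℝ} (hε : 0 < ε) :
    ∃ δ > 0, volume.real (bumpSet δ) ≤ ε := by
  have hanti : Antitone fun k : ℕ => bumpSet (1 / ((k : ℝ) + 1)) := by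
    intro k k' hk t ht
    refine ⟨ht.1, ht.2.trans_le ?_⟩
    exact one_div_le_one_div_of_le (by positivity) (by exact_mod_cast Nat.succ_le_succ hk)
  have hfin : ∀ δ, volume (bumpSet δ) ≠ ⊤ := fun δ =>
    ((measure_mono (fun t ht => ht.1 : bumpSet δ ⊆ Ioc (0 : ℝ) 1)).trans_lt (by simp)).ne
  have hlim := tendsto_measure_iInter_atTop (μ := (volume : Measure ℝ))
    (fun k : ℕ => (measurableSet_bumpSet (1 / ((k : ℝ) + 1))).nullMeasurableSet) hanti ⟨0, hfin _⟩
  have hzero : volume (⋂ k : ℕ, bumpSet (1 / ((k : ℝ) + 1))) = 0 := by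
    -- On the period `(0, 1]` the sine vanishes only at the right endpoint.
    refine measure_mono_null (t := {1}) (fun t ht => ?_) (by simp)
    rw [mem_iInter] at ht
    obtain ⟨⟨h0, h1⟩, -⟩ := ht 0
    by_contra hne
    have hlt : t < 1 := lt_of_le_of_ne h1 hne
    have hsin : 0 < Real.sin (Real.pi * t) :=
      Real.sin_pos_of_pos_of_lt_pi (by positivity) (by nlinarith [Real.pi_pos])
    obtain ⟨k, hk⟩ := exists_nat_one_div_lt (pow_pos hsin 2)
    exact lt_asymm hk (ht k).2
  rw [hzero] at hlim
  obtain ⟨k, hk⟩ := ((ENNReal.tendsto_nhds_zero.mp hlim) (ENNReal.ofReal ε)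
    (by simpa using hε)).exists
  exact ⟨1 / ((k : ℝ) + 1), by positivity, ENNReal.toReal_le_of_le_ofReal hε.le hk⟩

/-- A smooth periodic density of mean one along which the average of the profile of `h` is close
to the Huber function. -/
lemma exists_periodic_density {ℓ r ε : ℝ} (hℓ : 0 < ℓ) (hr : ℓ / 2 < r) (hε : 0 < ε) :
    ∃ q : ℝ → ℝ, ContDiff ℝ ∞ q ∧ Function.Periodic q 1 ∧ (∀ t, 0 ≤ q t) ∧
      ∫ t in (0 : ℝ)..1, q t = 1 ∧
      ∫ t in (0 : ℝ)..1, radialDensity ℓ (q t * r) ≤ huber ℓ r + ε := by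
  have hr0 : 0 < r := by linarith
  obtain ⟨δ, hδ, hvol⟩ := exists_volume_bumpSet_le (ε := ε / (ℓ ^ 2 / 4)) (by positivity)
  have hbc : Continuous (periodicBump δ) := (contDiff_periodicBump δ).continuous
  have hb0 : ∀ t, 0 ≤ periodicBump δ t := fun t => expNegInvGlue.nonneg _
  set I := ∫ t in (0 : ℝ)..1, periodicBump δ t with hI
  have hI0 : 0 < I := intervalIntegral.integral_pos zero_lt_one hbc.continuousOn
    (fun t _ => hb0 t) ⟨0, by simp, expNegInvGlue.pos_of_pos (by simpa using hδ)⟩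
  -- Off the bump the density equals `c`, where the profile sits at the point of tangency `ℓ / 2`;
  -- the remaining mass `1 - c` goes into the bump.
  set c := ℓ / (2 * r) with hc
  have hcr : c * r = ℓ / 2 := by rw [hc]; field_simp
  have hc0 : 0 < c := by positivity
  have hc1 : c < 1 := by rw [hc, div_lt_one (by positivity)]; linarith
  set f := fun t => periodicBump δ t / I with hf
  have hfc : Continuous f := hbc.div_const I
  have hf0 : ∀ t, 0 ≤ f t := fun t => div_nonneg (hb0 t) hI0.le
  have hfI : ∫ t in (0 : ℝ)..1, f t = 1 := by
    rw [hf, intervalIntegral.integral_div, ← hI, div_self hI0.ne']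
  have hqc : Continuous fun t => c + (1 - c) * f t := by fun_prop
  refine ⟨fun t => c + (1 - c) * f t, contDiff_const.add (contDiff_const.mul
    ((contDiff_periodicBump δ).div_const I)), fun t => ?_, fun t => ?_, ?_, ?_⟩
  · simp only [hf]
    rw [periodic_periodicBump δ t]
  · have := hf0 t
    have : 0 ≤ 1 - c := by linarith
    positivity
  · beta_reduce
    have hi : IntervalIntegrable (fun t => (1 - c) * f t) volume 0 1 :=
      (continuous_const.mul hfc).intervalIntegrable _ _
    rw [intervalIntegral.integral_add intervalIntegrable_const hi, intervalIntegral.integral_const_mul, hfI]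
    simp
  · have hS : bumpSet δ ⊆ Ioc 0 1 := fun t ht => ht.1
    -- The first two terms average to `ℓ * r - ℓ ^ 2 / 4`; the linear bound used on the bump costs
    -- an extra `ℓ ^ 2 / 4` there only.
    have hpt : ∀ t ∈ Ioc (0 : ℝ) 1, radialDensity ℓ ((c + (1 - c) * f t) * r) ≤
        ℓ ^ 2 / 4 + ℓ * (r - ℓ / 2) * f t +
          (bumpSet δ).indicator (fun _ => ℓ ^ 2 / 4) t := by
      intro t ht
      have e : (c + (1 - c) * f t) * r = ℓ / 2 + (r - ℓ / 2) * f t := by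
        rw [← hcr]; ring
      rw [e]
      by_cases h : t ∈ bumpSet δ
      · rw [indicator_of_mem h]
        refine (min_le_right _ _).trans (le_of_eq ?_)
        ring
      · rw [indicator_of_notMem h]
        have hft : f t = 0 := by
          simp only [hf, periodicBump]
          rw [expNegInvGlue.zero_of_nonpos, zero_div]
          by_contra hcon
          exact h ⟨ht, by linarith⟩
        rw [hft]
        refine (min_le_left _ _).trans (le_of_eq ?_)
        ring
    have i1 : IntegrableOn (fun _ : ℝ => ℓ ^ 2 / 4) (Ioc 0 1) := integrableOn_const (by simp)
    have i2 : IntegrableOn (fun t => ℓ * (r - ℓ / 2) * f t) (Ioc 0 1) :=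
      ((continuous_const.mul hfc).integrableOn_Icc (a := 0) (b := 1)).mono_set Ioc_subset_Icc_self
    have i12 : IntegrableOn (fun t => ℓ ^ 2 / 4 + ℓ * (r - ℓ / 2) * f t) (Ioc 0 1) := i1.add i2
    have i3 : IntegrableOn ((bumpSet δ).indicator fun _ => ℓ ^ 2 / 4) (Ioc 0 1) :=
      i1.indicator (measurableSet_bumpSet δ)
    have i4 : IntegrableOn (fun t => radialDensity ℓ ((c + (1 - c) * f t) * r)) (Ioc 0 1) :=
      (((continuous_radialDensity ℓ).comp (hqc.mul continuous_const)).integrableOn_Icc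
        (a := 0) (b := 1)).mono_set Ioc_subset_Icc_self
    rw [intervalIntegral.integral_of_le zero_le_one] at hfI ⊢
    refine (setIntegral_mono_on i4 (i12.add i3) measurableSet_Ioc hpt).trans ?_
    simp only [Pi.add_apply]
    rw [integral_add i12 i3, integral_add i1 i2, setIntegral_const, integral_const_mul, hfI,
      integral_indicator (measurableSet_bumpSet δ), setIntegral_const,
      measureReal_restrict_apply (measurableSet_bumpSet δ), inter_eq_left.mpr hS,
      huber, if_neg (by linarith)]
    rw [le_div_iff₀ (by positivity)] at hvol
    simp only [Real.volume_real_Ioc, sub_zero, zero_le_one, sup_of_le_left, smul_eq_mul,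
      mul_one]
    linarith

/-- A periodic density of mean one has, after subtracting one, a smooth bounded primitive. -/
lemma exists_bounded_primitive {q : ℝ → ℝ} (hq : ContDiff ℝ ∞ q) (hper : Function.Periodic q 1)
    (hmean : ∫ t in (0 : ℝ)..1, q t = 1) :
    ∃ P : ℝ → ℝ, ContDiff ℝ ∞ P ∧ (∀ t, HasDerivAt P (q t - 1) t) ∧ ∃ C, ∀ t, |P t| ≤ C := by
  have hqc := hq.continuous
  have hc : Continuous fun t => q t - 1 := hqc.sub continuous_const
  set P := fun t => ∫ x in (0 : ℝ)..t, (q x - 1) with hP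
  have hder : ∀ t, HasDerivAt P (q t - 1) t := fun t =>
    (hc.integral_hasStrictDerivAt 0 t).hasDerivAt
  have hPd : Differentiable ℝ P := fun t => (hder t).differentiableAt
  -- The increment over a period vanishes because `q` has mean one; boundedness follows from
  -- periodicity.
  have hPper : Function.Periodic P 1 := by
    intro t
    have hp : Function.Periodic (fun t => q t - 1) 1 := fun t => by
      simp only [hper t]
    have h1 := hp.intervalIntegral_add_eq t 0
    have h2 := intervalIntegral.integral_add_adjacent_intervals
      (hc.intervalIntegrable (μ := volume) 0 t) (hc.intervalIntegrable t (t + 1))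
    have h3 : ∫ x in (0 : ℝ)..1, (q x - 1) = 0 := by
      rw [intervalIntegral.integral_sub (hqc.intervalIntegrable _ _) (by simp), hmean]
      simp
    rw [zero_add, h3] at h1
    simp only [hP]
    rw [← h2, h1, add_zero]
  refine ⟨P, ?_, hder, ?_⟩
  · rw [contDiff_infty_iff_deriv]
    refine ⟨hPd, ?_⟩
    have : deriv P = fun t => q t - 1 := funext fun t => (hder t).deriv
    rw [this]
    exact hq.sub contDiff_const
  · obtain ⟨C, hC⟩ := (hPper.isBounded_of_continuous one_ne_zero hPd.continuous).exists_norm_le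
    exact ⟨C, fun t => hC _ (mem_range_self t)⟩

end Profile

section Cutoff
variable {n : ℕ}

open scoped Manifold in
/-- Smooth cutoff functions on the cube which are equal to one on most of it. -/
lemma exists_cutoff (n : ℕ) {ε : ℝ} (hε : 0 < ε) :
    ∃ (χ : EuclideanSpace ℝ (Fin n) → ℝ) (K : Set (EuclideanSpace ℝ (Fin n))),
      ContDiff ℝ ∞ χ ∧ tsupport χ ⊆ unitCube n ∧ (∀ x, χ x ∈ Icc (0 : ℝ) 1) ∧
      IsCompact K ∧ K ⊆ unitCube n ∧ (∀ x ∈ K, χ x = 1) ∧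
      volume.real (unitCube n \ K) ≤ ε := by
  obtain ⟨K, hKU, hK, hvol⟩ : ∃ K ⊆ unitCube n, IsCompact K ∧
      volume.real (unitCube n \ K) ≤ ε := by
    obtain ⟨K, hKU, hK, hvol⟩ := (isOpen_unitCube n).measurableSet.exists_isCompact_sdiff_lt
      (volume_unitCube_ne_top n) (ε := ENNReal.ofReal ε) (by simpa using hε)
    exact ⟨K, hKU, hK, ENNReal.toReal_le_of_le_ofReal hε.le hvol.le⟩
  obtain ⟨f, h0, h1, hf⟩ := exists_contMDiffMap_zero_one_nhds_of_isClosed (n := ⊤)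
    𝓘(ℝ, EuclideanSpace ℝ (Fin n)) (isOpen_unitCube n).isClosed_compl hK.isClosed
    (disjoint_compl_left_iff_subset.mpr hKU)
  refine ⟨f, K, f.contMDiff.contDiff, fun x hx => ?_, hf, hK, hKU, fun x hx => ?_, hvol⟩
  · by_contra hcon
    have := eventually_nhdsSet_iff_forall.mp h0 x hcon
    exact (notMem_tsupport_iff_eventuallyEq.mpr this) hx
  · exact h1.self_of_nhdsSet x hx

end Cutoff

/-! ### Plane waves and the upper bound in rank-one directions -/

section Laminate
variable {m n : ℕ}

lemma hSimp_smul_add_le {ℓ c δ : ℝ} (hℓ : 0 < ℓ) (hc : 0 ≤ c) (ξ A : Matrix (Fin m) (Fin n) ℝ)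
    (hA : ‖A‖ ≤ δ) : hSimp m n ℓ (c • ξ + A) ≤ radialDensity ℓ (c * ‖ξ‖) + 2 * ℓ * δ := by
  have hδ : 0 ≤ δ := (norm_nonneg A).trans hA
  have h1 : ‖c • ξ + A‖ ≤ c * ‖ξ‖ + δ := by
    refine (norm_add_le _ _).trans (add_le_add (le_of_eq ?_) hA)
    rw [frobenius_norm_smul, abs_of_nonneg hc]
  exact (radialDensity_mono (norm_nonneg _) h1 hℓ).trans
    (radialDensity_add_le (by positivity) hδ hℓ)

/-- The plane wave `x ↦ χ(x) ν P(⟨b, x⟩ / ν + s) a`, cut off by `χ`. -/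
noncomputable def planeWave (χ : EuclideanSpace ℝ (Fin n) → ℝ) (P : ℝ → ℝ) (a : Fin m → ℝ)
    (b : Fin n → ℝ) (ν s : ℝ) (x : EuclideanSpace ℝ (Fin n)) : EuclideanSpace ℝ (Fin m) :=
  (χ x * (ν * P (ν⁻¹ * inner ℝ (WithLp.toLp 2 b) x + s))) • WithLp.toLp 2 a

variable {χ : EuclideanSpace ℝ (Fin n) → ℝ} {P q : ℝ → ℝ} {a : Fin m → ℝ} {b : Fin n → ℝ}

lemma isCubeTestFunction_planeWave (hχ : ContDiff ℝ ∞ χ) (hs : tsupport χ ⊆ unitCube n)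
    (hP : ContDiff ℝ ∞ P) (a : Fin m → ℝ) (b : Fin n → ℝ) (ν s : ℝ) :
    IsCubeTestFunction (planeWave χ P a b ν s) := by
  have hsub : tsupport (planeWave χ P a b ν s) ⊆ tsupport χ := by
    refine closure_mono fun x hx => ?_
    rw [Function.mem_support] at hx ⊢
    intro h
    exact hx (by simp [planeWave, h])
  have hin : ContDiff ℝ ∞ fun x : EuclideanSpace ℝ (Fin n) =>
      ν⁻¹ * inner ℝ (WithLp.toLp 2 b) x + s :=
    (contDiff_const.mul (contDiff_const.inner ℝ contDiff_id)).add contDiff_const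
  refine ⟨(hχ.mul (contDiff_const.mul (hP.comp hin))).smul contDiff_const, ?_, hsub.trans hs⟩
  exact (isCompact_closedUnitCube n).of_isClosed_subset (isClosed_tsupport _)
    ((hsub.trans hs).trans (unitCube_subset_closedUnitCube n))

/-- Differentiating the oscillation cancels the amplitude `ν` and yields a multiple of `a ⊗ b`;
differentiating the cutoff keeps the factor `ν`, an error that vanishes with it. -/
lemma add_gradMatrix_planeWave (hχ : Differentiable ℝ χ) (hP : ∀ t, HasDerivAt P (q t - 1) t)
    {ν : ℝ} (hν : ν ≠ 0) (s : ℝ) (x : EuclideanSpace ℝ (Fin n)) :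
    Matrix.vecMulVec a b + gradMatrix (planeWave χ P a b ν s) x =
      (1 + χ x * (q (ν⁻¹ * inner ℝ (WithLp.toLp 2 b) x + s) - 1)) • Matrix.vecMulVec a b +
      (ν * P (ν⁻¹ * inner ℝ (WithLp.toLp 2 b) x + s)) •
        Matrix.vecMulVec a (fun j => fderiv ℝ χ x (EuclideanSpace.single j 1)) := by
  have hin : HasFDerivAt (fun x : EuclideanSpace ℝ (Fin n) =>
      ν⁻¹ * inner ℝ (WithLp.toLp 2 b) x + s) (ν⁻¹ • innerSL ℝ (WithLp.toLp 2 b)) x :=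
    ((innerSL ℝ (WithLp.toLp 2 b)).hasFDerivAt.const_mul ν⁻¹).add_const s
  have h1 := ((hP (ν⁻¹ * inner ℝ (WithLp.toLp 2 b) x + s)).comp_hasFDerivAt x hin).const_mul ν
  have h2 := ((hχ x).hasFDerivAt.mul h1).smul_const (WithLp.toLp 2 a)
  have h3 : HasFDerivAt (planeWave χ P a b ν s) _ x := h2
  ext i j
  simp only [Matrix.add_apply, Matrix.smul_apply, Matrix.vecMulVec_apply, gradMatrix,
    Matrix.of_apply, h3.fderiv]
  have hb : inner ℝ (WithLp.toLp 2 b) (EuclideanSpace.single j (1 : ℝ)) = b j := by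
    simp [EuclideanSpace.inner_single_right]
  simp [hb]
  field_simp
  ring

/-- Every phase `s` gives a competitor, so the envelope is below the average over `s`. After Fubini
the oscillation is averaged at each fixed `x`, and no weak limit as `ν → 0` is needed. -/
lemma le_setIntegral_phase_average {ℓ : ℝ} (hℓ : 0 < ℓ) (hχ : ContDiff ℝ ∞ χ)
    (hs : tsupport χ ⊆ unitCube n) (hχ01 : ∀ x, χ x ∈ Icc (0 : ℝ) 1) (hP : ContDiff ℝ ∞ P)
    (hPq : ∀ t, HasDerivAt P (q t - 1) t) (hqc : Continuous q) (hq0 : ∀ t, 0 ≤ q t)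
    {ν δ : ℝ} (hν : ν ≠ 0)
    (hδ : ∀ x ∈ unitCube n, ∀ t, ‖(ν * P t) •
      Matrix.vecMulVec a (fun j => fderiv ℝ χ x (EuclideanSpace.single j 1))‖ ≤ δ) :
    qcEnvelope (hSimp m n ℓ) (Matrix.vecMulVec a b) ≤
      (∫ x in unitCube n, ∫ s in Ioc (0 : ℝ) 1, radialDensity ℓ
        ((1 + χ x * (q (ν⁻¹ * inner ℝ (WithLp.toLp 2 b) x + s) - 1)) *
          ‖Matrix.vecMulVec a b‖)) + 2 * ℓ * δ := by
  set ξ := Matrix.vecMulVec a b with hξ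
  set F : EuclideanSpace ℝ (Fin n) → ℝ → ℝ := fun x s => radialDensity ℓ
    ((1 + χ x * (q (ν⁻¹ * inner ℝ (WithLp.toLp 2 b) x + s) - 1)) * ‖ξ‖) with hF
  have hχc := hχ.continuous
  have hFc : Continuous (Function.uncurry F) := by
    refine (continuous_radialDensity ℓ).comp ?_
    have : Continuous fun p : EuclideanSpace ℝ (Fin n) × ℝ =>
        ν⁻¹ * inner ℝ (WithLp.toLp 2 b) p.1 + p.2 := by fun_prop
    have h2 := hqc.comp this
    have h3 := hχc.comp (continuous_fst (X := EuclideanSpace ℝ (Fin n)) (Y := ℝ))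
    exact (continuous_const.add (h3.mul (h2.sub continuous_const))).mul continuous_const
  have hFint : Integrable (Function.uncurry F)
      ((volume.restrict (unitCube n)).prod (volume.restrict (Ioc (0 : ℝ) 1))) := by
    rw [Measure.prod_restrict]
    exact (hFc.continuousOn.integrableOn_compact
      ((isCompact_closedUnitCube n).prod (isCompact_Icc (a := (0 : ℝ)) (b := 1)))).mono_set
      (prod_mono (unitCube_subset_closedUnitCube n) Ioc_subset_Icc_self)
  have hphase : ∀ s, qcEnvelope (hSimp m n ℓ) ξ ≤ (∫ x in unitCube n, F x s) + 2 * ℓ * δ := by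
    intro s
    have htest := isCubeTestFunction_planeWave hχ hs hP a b ν s
    have hFs : IntegrableOn (fun x => F x s) (unitCube n) :=
      (hFc.comp (continuous_id.prodMk continuous_const)).integrableOn_unitCube
    have hcst : IntegrableOn (fun _ => 2 * ℓ * δ) (unitCube n) :=
      integrableOn_const (volume_unitCube_ne_top n)
    refine (qcEnvelope_le_setIntegral ξ hℓ htest).trans ?_
    have : (∫ x in unitCube n, F x s) + 2 * ℓ * δ = ∫ x in unitCube n, (F x s + 2 * ℓ * δ) := by
      rw [integral_add hFs hcst, setIntegral_const, volume_real_unitCube, one_smul]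
    rw [this]
    refine setIntegral_mono_on
      (continuous_hSimp ℓ (htest.continuous_add_gradMatrix_apply ξ)).integrableOn_unitCube
      (hFs.add hcst) (isOpen_unitCube n).measurableSet fun x hx => ?_
    rw [hξ, add_gradMatrix_planeWave (hχ.differentiable (by norm_num)) hPq hν]
    refine hSimp_smul_add_le hℓ ?_ _ _ (hδ x hx _)
    have h1 := hχ01 x
    have h2 := mul_nonneg h1.1 (hq0 (ν⁻¹ * inner ℝ (WithLp.toLp 2 b) x + s))
    linarith [h1.2]
  have hvol : (volume.restrict (Ioc (0 : ℝ) 1)).real univ = 1 := by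
    simp [measureReal_def]
  have hic : Integrable (fun _ => 2 * ℓ * δ) (volume.restrict (Ioc (0 : ℝ) 1)) :=
    integrable_const _
  have hiF : Integrable (fun s => ∫ x in unitCube n, F x s) (volume.restrict (Ioc (0 : ℝ) 1)) :=
    hFint.integral_prod_right
  calc qcEnvelope (hSimp m n ℓ) ξ
      = ∫ s in Ioc (0 : ℝ) 1, qcEnvelope (hSimp m n ℓ) ξ := by
        rw [integral_const, hvol, one_smul]
    _ ≤ ∫ s in Ioc (0 : ℝ) 1, ((∫ x in unitCube n, F x s) + 2 * ℓ * δ) :=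
        integral_mono (integrable_const _) (hiF.add hic) hphase
    _ = (∫ x in unitCube n, ∫ s in Ioc (0 : ℝ) 1, F x s) + 2 * ℓ * δ := by
        rw [integral_add hiF hic, integral_const, hvol, one_smul, integral_integral_swap hFint]

lemma setIntegral_phase_le_of_eq_one {ℓ r c A : ℝ} (hper : Function.Periodic q 1)
    (hA : ∫ t in (0 : ℝ)..1, radialDensity ℓ (q t * r) ≤ A) :
    ∫ s in Ioc (0 : ℝ) 1, radialDensity ℓ ((1 + 1 * (q (c + s) - 1)) * r) ≤ A := by
  have hp : Function.Periodic (fun t => radialDensity ℓ (q t * r)) 1 := fun t => by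
    simp only [hper t]
  have h1 := hp.intervalIntegral_add_eq c 0
  have h2 : ∫ s in (0 : ℝ)..1, radialDensity ℓ (q (c + s) * r) =
      ∫ t in (c + 0)..(c + 1), radialDensity ℓ (q t * r) :=
    intervalIntegral.integral_comp_add_left (fun t => radialDensity ℓ (q t * r)) c
  rw [add_zero, h1, zero_add, intervalIntegral.integral_of_le zero_le_one] at h2
  refine le_trans (le_of_eq ?_) (h2.trans_le hA)
  congr 1
  funext s
  congr 2
  ring

/-- A crude bound from the linear branch, for the transition layer of the cutoff, whose volume is
small. -/
lemma setIntegral_phase_le {ℓ r c k : ℝ} (hℓ : 0 < ℓ) (hr : 0 ≤ r) (hqc : Continuous q)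
    (hper : Function.Periodic q 1) (hq0 : ∀ t, 0 ≤ q t) (hmean : ∫ t in (0 : ℝ)..1, q t = 1)
    (hk : k ∈ Icc (0 : ℝ) 1) :
    ∫ s in Ioc (0 : ℝ) 1, radialDensity ℓ ((1 + k * (q (c + s) - 1)) * r) ≤ 2 * ℓ * r := by
  have h1 := hper.intervalIntegral_add_eq c 0
  have h2 : ∫ s in (0 : ℝ)..1, q (c + s) = ∫ t in (c + 0)..(c + 1), q t :=
    intervalIntegral.integral_comp_add_left q c
  rw [add_zero, h1, zero_add, hmean, intervalIntegral.integral_of_le zero_le_one] at h2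
  have hqs : Continuous fun s => q (c + s) := hqc.comp (continuous_const.add continuous_id)
  have i1 : IntegrableOn (fun _ : ℝ => ℓ * r) (Ioc (0 : ℝ) 1) := integrableOn_const (by simp)
  have i2 : IntegrableOn (fun s => ℓ * r * q (c + s)) (Ioc 0 1) :=
    ((continuous_const.mul hqs).integrableOn_Icc (a := 0) (b := 1)).mono_set Ioc_subset_Icc_self
  have i3 : IntegrableOn (fun s => radialDensity ℓ ((1 + k * (q (c + s) - 1)) * r))
      (Ioc 0 1) :=
    (((continuous_radialDensity ℓ).comp ((continuous_const.add (continuous_const.mul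
      (hqs.sub continuous_const))).mul continuous_const)).integrableOn_Icc
      (a := 0) (b := 1)).mono_set Ioc_subset_Icc_self
  have h3 : ∫ s in Ioc (0 : ℝ) 1, radialDensity ℓ ((1 + k * (q (c + s) - 1)) * r) ≤
      ∫ s in Ioc (0 : ℝ) 1, (ℓ * r + ℓ * r * q (c + s)) := by
    refine setIntegral_mono_on i3 (i1.add i2) measurableSet_Ioc fun s _ => ?_
    refine (min_le_right _ _).trans ?_
    have h4 := hq0 (c + s)
    have h5 : 1 + k * (q (c + s) - 1) ≤ 1 + q (c + s) := by nlinarith [hk.1, hk.2]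
    have h6 := mul_le_mul_of_nonneg_left (mul_le_mul_of_nonneg_right h5 hr) hℓ.le
    linarith
  rw [integral_add i1 i2, setIntegral_const, integral_const_mul, h2] at h3
  simp only [Real.volume_real_Ioc, sub_zero, zero_le_one, sup_of_le_left, one_smul] at h3
  linarith

/-- In rank-one directions the quasiconvex envelope is at most the Huber function. -/
lemma qcEnvelope_vecMulVec_le {ℓ : ℝ} (hℓ : 0 < ℓ) (a : Fin m → ℝ) (b : Fin n → ℝ)
    (hξ : ℓ / 2 < ‖Matrix.vecMulVec a b‖) :
    qcEnvelope (hSimp m n ℓ) (Matrix.vecMulVec a b) ≤ huber ℓ ‖Matrix.vecMulVec a b‖ := by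
  set ξ := Matrix.vecMulVec a b with hξdef
  have hξ0 : 0 < ‖ξ‖ := by linarith
  refine le_of_forall_pos_le_add fun ε hε => ?_
  obtain ⟨q, hq, hper, hq0, hmean, hA⟩ := exists_periodic_density hℓ hξ (ε := ε / 3) (by positivity)
  obtain ⟨P, hP, hPq, C, hC⟩ := exists_bounded_primitive hq hper hmean
  obtain ⟨χ, K, hχ, hχs, hχ01, hK, hKU, hχK, hvol⟩ :=
    exists_cutoff n (ε := ε / 3 / (2 * ℓ * ‖ξ‖)) (by positivity)
  have hqc := hq.continuous
  obtain ⟨G, hG⟩ := (isCompact_closedUnitCube n).exists_bound_of_continuousOn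
    (f := fun x => ‖Matrix.vecMulVec a (fun j => fderiv ℝ χ x (EuclideanSpace.single j 1))‖)
    (continuous_frobenius_norm fun i j => continuous_const.mul
      ((hχ.continuous_fderiv (by norm_num)).clm_apply continuous_const)).continuousOn
  simp only [norm_norm] at hG
  -- Makes the cutoff error at most `ε / 3`; the `+ 1` keeps the denominator positive if `C` or `G`
  -- is zero.
  set ν := ε / 3 / (2 * ℓ * (|C| * |G| + 1)) with hν
  have hν0 : 0 < ν := by positivity
  have hδ : ∀ x ∈ unitCube n, ∀ t, ‖(ν * P t) •
      Matrix.vecMulVec a (fun j => fderiv ℝ χ x (EuclideanSpace.single j 1))‖ ≤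
      ν * (|C| * |G|) := by
    intro x hx t
    rw [frobenius_norm_smul, abs_mul, abs_of_pos hν0, mul_assoc]
    refine mul_le_mul_of_nonneg_left ?_ hν0.le
    exact mul_le_mul ((hC t).trans (le_abs_self _))
      ((hG x (unitCube_subset_closedUnitCube n hx)).trans (le_abs_self _)) (norm_nonneg _)
      (abs_nonneg _)
  have h1 := le_setIntegral_phase_average (b := b) hℓ hχ hχs hχ01 hP hPq hqc hq0 hν0.ne' hδ
  rw [← hξdef] at h1
  have hsmall : 2 * ℓ * (ν * (|C| * |G|)) ≤ ε / 3 := by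
    have h2 : 2 * ℓ * (ν * (|C| * |G| + 1)) = ε / 3 := by
      rw [hν]
      field_simp
    have h3 : 0 ≤ 2 * ℓ * ν := by positivity
    nlinarith
  set A := huber ℓ ‖ξ‖ + ε / 3 with hAdef
  have hA0 : 0 ≤ A := by
    refine le_trans ?_ hA
    exact intervalIntegral.integral_nonneg zero_le_one fun t _ =>
      radialDensity_nonneg hℓ (mul_nonneg (hq0 t) hξ0.le)
  have hKm : MeasurableSet Kᶜ := hK.measurableSet.compl
  have hB : 0 < 2 * ℓ * ‖ξ‖ := by positivity
  have hpt : ∀ x, ∫ s in Ioc (0 : ℝ) 1, radialDensity ℓ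
        ((1 + χ x * (q (ν⁻¹ * inner ℝ (WithLp.toLp 2 b) x + s) - 1)) * ‖ξ‖) ≤
      A + Kᶜ.indicator (fun _ => 2 * ℓ * ‖ξ‖) x := by
    intro x
    by_cases hx : x ∈ K
    · rw [indicator_of_notMem (by simpa using hx), hχK x hx, add_zero]
      exact setIntegral_phase_le_of_eq_one hper hA
    · rw [indicator_of_mem (by simpa using hx)]
      exact (setIntegral_phase_le hℓ hξ0.le hqc hper hq0 hmean (hχ01 x)).trans (by linarith)
  have iA : IntegrableOn (fun _ => A) (unitCube n) := integrableOn_const (volume_unitCube_ne_top n)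
  have iB : IntegrableOn (Kᶜ.indicator fun _ => 2 * ℓ * ‖ξ‖) (unitCube n) :=
    (integrableOn_const (volume_unitCube_ne_top n)).indicator hKm
  have h2 : ∫ x in unitCube n, ∫ s in Ioc (0 : ℝ) 1, radialDensity ℓ
        ((1 + χ x * (q (ν⁻¹ * inner ℝ (WithLp.toLp 2 b) x + s) - 1)) * ‖ξ‖) ≤
      ∫ x in unitCube n, (A + Kᶜ.indicator (fun _ => 2 * ℓ * ‖ξ‖) x) := by
    refine integral_mono_of_nonneg (Filter.Eventually.of_forall fun x => ?_) (iA.add iB)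
      (Filter.Eventually.of_forall hpt)
    refine integral_nonneg fun s => radialDensity_nonneg hℓ (mul_nonneg ?_ hξ0.le)
    have h3 := hχ01 x
    have h4 := mul_nonneg h3.1 (hq0 (ν⁻¹ * inner ℝ (WithLp.toLp 2 b) x + s))
    linarith [h3.2]
  have hset : Kᶜ ∩ unitCube n = unitCube n \ K := by
    rw [inter_comm]
    rfl
  rw [integral_add iA iB, setIntegral_const, volume_real_unitCube, one_smul,
    integral_indicator hKm, setIntegral_const, measureReal_restrict_apply hKm, hset,
    smul_eq_mul] at h2
  rw [le_div_iff₀ hB] at hvol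
  linarith

lemma qcEnvelope_eq_huber_of_rank_le_one {ℓ : ℝ} (hℓ : 0 < ℓ) {ξ : Matrix (Fin m) (Fin n) ℝ}
    (h : ξ.rank ≤ 1) : qcEnvelope (hSimp m n ℓ) ξ = huber ℓ ‖ξ‖ := by
  refine le_antisymm ?_ (huber_le_qcEnvelope ξ hℓ)
  by_cases hξ : ‖ξ‖ ≤ ℓ / 2
  · rw [huber, if_pos hξ]
    exact (qcEnvelope_le_hSimp ξ hℓ).trans (min_le_left _ _)
  · obtain ⟨a, b, rfl⟩ := exists_eq_vecMulVec_of_rank_le_one h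
    exact qcEnvelope_vecMulVec_le hℓ a b (not_le.mp hξ)

end Laminate

theorem lemma2p4 (m n : ℕ) (ℓ : ℝ) (hℓ : 0 < ℓ) :
    (∀ ξ : Matrix (Fin m) (Fin n) ℝ, ‖ξ‖ ≤ ℓ / 2 →
      hSimp m n ℓ ξ = qcEnvelope (hSimp m n ℓ) ξ ∧
      qcEnvelope (hSimp m n ℓ) ξ = convEnvelope (hSimp m n ℓ) ξ) ∧
    (∀ ξ : Matrix (Fin m) (Fin n) ℝ, ξ.rank ≤ 1 →
      qcEnvelope (hSimp m n ℓ) ξ = convEnvelope (hSimp m n ℓ) ξ) ∧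
    (∀ ξ : Matrix (Fin m) (Fin n) ℝ, 2 ≤ ξ.rank → ℓ / 2 < ‖ξ‖ →
      convEnvelope (hSimp m n ℓ) ξ < qcEnvelope (hSimp m n ℓ) ξ) ∧
    (2 ≤ m → 2 ≤ n → ¬ ConvexOn ℝ univ (qcEnvelope (hSimp m n ℓ))) := by
  refine ⟨fun ξ hξ => ?_, fun ξ hξ => ?_, fun ξ hr hξ => convEnvelope_lt_qcEnvelope hℓ hr hξ,
    fun hm hn hconv => ?_⟩
  · have h1 : huber ℓ ‖ξ‖ = ‖ξ‖ ^ 2 := if_pos hξ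
    have h2 : hSimp m n ℓ ξ = ‖ξ‖ ^ 2 := hSimp_eq_sq ξ (by linarith)
    have h3 : qcEnvelope (hSimp m n ℓ) ξ = ‖ξ‖ ^ 2 :=
      le_antisymm ((qcEnvelope_le_hSimp ξ hℓ).trans_eq h2) (h1 ▸ huber_le_qcEnvelope ξ hℓ)
    exact ⟨h2.trans h3.symm, by rw [h3, convEnvelope_hSimp hℓ, h1]⟩
  · rw [qcEnvelope_eq_huber_of_rank_le_one hℓ hξ, convEnvelope_hSimp hℓ]
  -- A matrix with strict gap: the leading minor is `ℓ ^ 2` and the norm is at least `ℓ`. A convex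
  -- quasiconvex envelope would be a convex minorant of `h`, hence below the Huber function.
  · set ξ : Matrix (Fin m) (Fin n) ℝ := Matrix.of fun i j => if (i : ℕ) = j then ℓ else 0 with hξ
    set i₀ : Fin m := ⟨0, by omega⟩
    set i₁ : Fin m := ⟨1, by omega⟩
    set j₀ : Fin n := ⟨0, by omega⟩
    set j₁ : Fin n := ⟨1, by omega⟩
    have hrank : 2 ≤ ξ.rank := two_le_rank_of_minor_ne_zero (i := i₀) (i' := i₁) (j := j₀)
      (j' := j₁) (by simp [hξ, i₀, i₁, j₀, j₁, hℓ.ne'])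
    have hnorm : ℓ / 2 < ‖ξ‖ := by
      have h1 := abs_apply_le_frobenius_norm ξ i₀ j₀
      have h2 : ξ i₀ j₀ = ℓ := by simp [hξ, i₀, j₀]
      rw [h2, abs_of_pos hℓ] at h1
      linarith
    refine absurd (convEnvelope_lt_qcEnvelope hℓ hrank hnorm) (not_lt.mpr ?_)
    rw [convEnvelope_hSimp hℓ]
    exact le_huber_of_convexOn hℓ hconv (fun η => qcEnvelope_le_hSimp η hℓ) ξ
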